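/- Let $\Gamma$ be a finite abelian group acting faithfully and linearly on a finite-dimensional real vector space $V$. For $\gamma\in\Gamma$ let $l(\gamma)$ be the codimension of the fixed subspace $V^\gamma$, let $N^\gamma$ be the $\gamma$-invariant complement of $V^\gamma$ in $V$ (the sum of the nontrivial representations of $\langle\gamma\rangle$), and identify $(V^\gamma)^*$ with the subspace of $\gamma$-fixed vectors of $V^*$. A linear cocycle is an element $$\pi=(\pi_\gamma)_{\gamma}\in (V^*\otimes\wedge^2V)^\Gamma\oplus\Big(\bigoplus_{l(\gamma)=2}(V^\gamma)^*\otimes\wedge^2N^\gamma\Big)^\Gamma,$$ where the first summand is the component at $\gamma=1$; each $\pi_\gamma$ is viewed as an alternating bilinear map $V^*\times V^*\to V^*$, and invariance means ${}^g\pi_\gamma({}^{g^{-1}}x,{}^{g^{-1}}y)=\pi_{g\gamma g^{-1}}(x,y)$. Put $$[\![\pi,\pi]\!]_\gamma(x,y,z)=\sum_{\alpha\beta=\gamma}\big(\pi_\alpha(\pi_\beta(x,y),z+{}^\beta z)+\pi_\alpha(\pi_\beta(y,z),x+{}^\beta x)+\pi_\alpha(\pi_\beta(z,x),y+{}^\beta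 y)\big),$$ and let $\mathrm{pr}_\gamma$ be the projection of $V^*\otimes\wedge^3V$ onto $(V^\gamma)^*\otimes\wedge^{3-l(\gamma)}V^\gamma\otimes\wedge^{l(\gamma)}N^\gamma$ (zero if $l(\gamma)>3$). A linear Poisson structure on $S(V^*)\rtimes\Gamma$ is a linear cocycle $\pi$ with $[\pi,\pi]_\gamma:=\mathrm{pr}_\gamma\circ[\![\pi,\pi]\!]_\gamma=0$ for all $\gamma$. Theorem. Every linear Poisson structure $\pi$ on $S(V^*)\rtimes\Gamma$ is quantizable, without any correction term of order $\hbar^2$. Precisely: (1) The Braverman–Gaitsgory conditions hold with zero constant term: for all $\gamma\in\Gamma$, $[\![\pi,\pi]\!]_\gamma=0$ and $\partial_\gamma(\pi_\gamma)=0$ in $S^2(V^*)\otimes\wedge^3V$, where $\partial_\gamma(\pi_\gamma)(x_0,x_1,x_2)=\sum_{i}(-1)^i\pi_\gamma(\dots,\widehat{x_i},\dots)\,(x_i-{}^\gamma x_i)$. (2) The quotient of $T(V^*)\rtimes\Gamma$ by the relations $x\otimes y-y\otimes x=\sum_\gamma\pi_\gamma(x,y)\gamma$ ($x,y\in V^*$),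 filtered by the number of letters from $V^*$, has the PBW property: the canonical surjection from $T(V^*)\rtimes\Gamma$ onto its associated graded algebra induces an isomorphism from $S(V^*)\rtimes\Gamma$. (3) There is a formal deformation of $A=S(V^*)\rtimes\Gamma$, that is, an associative unital $\mathbb R[[\hbar]]$-bilinear product $a\star b=ab+\sum_{n\ge1}\hbar^nm_n(a,b)$ on $A[[\hbar]]$, such that $g\star a=ga$ and $a\star g=ag$ for $g\in\Gamma$, $a\in A$, and $$x\star y-y\star x=\hbar\sum_{\gamma\in\Gamma}\pi_\gamma(x,y)\gamma\qquad (x,y\in V^*)$$ exactly. -/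

import Mathlib

noncomputable section

open scoped BigOperators

namespace OrbifoldPoisson

variable {Γ V : Type*} [Group Γ] [AddCommGroup V] [Module ℝ V]

/-! ### The crossed products `S(V*) ⋊ Γ` and `T(V*) ⋊ Γ` -/

/-- The symmetric algebra `S(V*)`, as a type remembering the representation `ρ` of `Γ` on `V`
(so that it can carry the induced action of `Γ`). -/
def SymV (_ρ : Representation ℝ Γ V) : Type _ := SymmetricAlgebra ℝ (Module.Dual ℝ V)

/-- The tensor algebra `T(V*)`, as a type remembering the representation `ρ` of `Γ` on `V`. -/
def TensV (_ρ : Representation ℝ Γ V) : Type _ := TensorAlgebra ℝ (Module.Dual ℝ V)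

instance (ρ : Representation ℝ Γ V) : CommRing (SymV ρ) :=
  inferInstanceAs (CommRing (SymmetricAlgebra ℝ (Module.Dual ℝ V)))

instance (ρ : Representation ℝ Γ V) : Algebra ℝ (SymV ρ) :=
  inferInstanceAs (Algebra ℝ (SymmetricAlgebra ℝ (Module.Dual ℝ V)))

instance (ρ : Representation ℝ Γ V) : Ring (TensV ρ) :=
  inferInstanceAs (Ring (TensorAlgebra ℝ (Module.Dual ℝ V)))

instance (ρ : Representation ℝ Γ V) : Algebra ℝ (TensV ρ) :=
  inferInstanceAs (Algebra ℝ (TensorAlgebra ℝ (Module.Dual ℝ V)))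

/-- The inclusion `V* → S(V*)`. -/
def SymV.ι (ρ : Representation ℝ Γ V) : Module.Dual ℝ V →ₗ[ℝ] SymV ρ :=
  SymmetricAlgebra.ι ℝ (Module.Dual ℝ V)

/-- The inclusion `V* → T(V*)`. -/
def TensV.ι (ρ : Representation ℝ Γ V) : Module.Dual ℝ V →ₗ[ℝ] TensV ρ :=
  TensorAlgebra.ι ℝ

/-- The canonical surjection `T(V*) → S(V*)`. -/
def TensV.toSym (ρ : Representation ℝ Γ V) : TensV ρ →ₐ[ℝ] SymV ρ :=
  SymmetricAlgebra.algHom ℝ (Module.Dual ℝ V)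

/-- The algebra endomorphism of `S(V*)` extending the dual action of `g` on `V*`. -/
def SymV.act (ρ : Representation ℝ Γ V) (g : Γ) : SymV ρ →ₐ[ℝ] SymV ρ :=
  SymmetricAlgebra.lift (SymmetricAlgebra.ι ℝ (Module.Dual ℝ V) ∘ₗ ρ.dual g)

/-- The algebra endomorphism of `T(V*)` extending the dual action of `g` on `V*`. -/
def TensV.act (ρ : Representation ℝ Γ V) (g : Γ) : TensV ρ →ₐ[ℝ] TensV ρ :=
  TensorAlgebra.lift ℝ (TensorAlgebra.ι ℝ ∘ₗ ρ.dual g)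

theorem SymV.algHom_ext {ρ : Representation ℝ Γ V} {f g : SymV ρ →ₐ[ℝ] SymV ρ}
    (h : ∀ x, f (SymV.ι ρ x) = g (SymV.ι ρ x)) : f = g :=
  SymmetricAlgebra.algHom_ext (LinearMap.ext h)

theorem TensV.algHom_ext {ρ : Representation ℝ Γ V} {f g : TensV ρ →ₐ[ℝ] TensV ρ}
    (h : ∀ x, f (TensV.ι ρ x) = g (TensV.ι ρ x)) : f = g :=
  TensorAlgebra.hom_ext (LinearMap.ext h)

theorem SymV.act_ι (ρ : Representation ℝ Γ V) (g : Γ) (x : Module.Dual ℝ V) :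
    SymV.act ρ g (SymV.ι ρ x) = SymV.ι ρ (ρ.dual g x) :=
  SymmetricAlgebra.lift_ι_apply _ x

theorem TensV.act_ι (ρ : Representation ℝ Γ V) (g : Γ) (x : Module.Dual ℝ V) :
    TensV.act ρ g (TensV.ι ρ x) = TensV.ι ρ (ρ.dual g x) :=
  TensorAlgebra.lift_ι_apply _ x

/-- The action of `Γ` on `S(V*)` by algebra automorphisms. -/
instance (ρ : Representation ℝ Γ V) : MulSemiringAction Γ (SymV ρ) where
  smul g s := SymV.act ρ g s
  one_smul s := by
    change SymV.act ρ 1 s = s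
    have : SymV.act ρ 1 = AlgHom.id ℝ (SymV ρ) :=
      SymV.algHom_ext fun x => by rw [SymV.act_ι, map_one]; rfl
    rw [this]; rfl
  mul_smul g h s := by
    change SymV.act ρ (g * h) s = SymV.act ρ g (SymV.act ρ h s)
    have : SymV.act ρ (g * h) = (SymV.act ρ g).comp (SymV.act ρ h) :=
      SymV.algHom_ext fun x => by
        rw [AlgHom.comp_apply, SymV.act_ι, SymV.act_ι, SymV.act_ι, map_mul]; rfl
    rw [this]; rfl
  smul_zero g := map_zero (SymV.act ρ g)
  smul_add g := map_add (SymV.act ρ g)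
  smul_one g := map_one (SymV.act ρ g)
  smul_mul g := map_mul (SymV.act ρ g)

/-- The action of `Γ` on `T(V*)` by algebra automorphisms. -/
instance (ρ : Representation ℝ Γ V) : MulSemiringAction Γ (TensV ρ) where
  smul g s := TensV.act ρ g s
  one_smul s := by
    change TensV.act ρ 1 s = s
    have : TensV.act ρ 1 = AlgHom.id ℝ (TensV ρ) :=
      TensV.algHom_ext fun x => by rw [TensV.act_ι, map_one]; rfl
    rw [this]; rfl
  mul_smul g h s := by
    change TensV.act ρ (g * h) s = TensV.act ρ g (TensV.act ρ h s)
    have : TensV.act ρ (g * h) = (TensV.act ρ g).comp (TensV.act ρ h) :=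
      TensV.algHom_ext fun x => by
        rw [AlgHom.comp_apply, TensV.act_ι, TensV.act_ι, TensV.act_ι, map_mul]; rfl
    rw [this]; rfl
  smul_zero g := map_zero (TensV.act ρ g)
  smul_add g := map_add (TensV.act ρ g)
  smul_one g := map_one (TensV.act ρ g)
  smul_mul g := map_mul (TensV.act ρ g)

instance (ρ : Representation ℝ Γ V) : SMulCommClass Γ ℝ (SymV ρ) where
  smul_comm g r s := map_smul (SymV.act ρ g) r s

instance (ρ : Representation ℝ Γ V) : SMulCommClass Γ ℝ (TensV ρ) where
  smul_comm g r s := map_smul (TensV.act ρ g) r s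

/-- The crossed product `S(V*) ⋊ Γ`: sums of `a·g` with `a ∈ S(V*)`, `g ∈ Γ`
(written `SkewMonoidAlgebra.single g a`), and `(a·g)(b·h) = a (ᵍb)·gh`. -/
abbrev SymCross (ρ : Representation ℝ Γ V) : Type _ := SkewMonoidAlgebra (SymV ρ) Γ

/-- The crossed product `T(V*) ⋊ Γ`. -/
abbrev TensCross (ρ : Representation ℝ Γ V) : Type _ := SkewMonoidAlgebra (TensV ρ) Γ

/-- The element `x·g` of `S(V*) ⋊ Γ`, for `x ∈ V*` and `g ∈ Γ`. -/
def SymCross.vec (ρ : Representation ℝ Γ V) (x : Module.Dual ℝ V) (g : Γ) : SymCross ρ :=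
  SkewMonoidAlgebra.single g (SymV.ι ρ x)

/-- The element `x·g` of `T(V*) ⋊ Γ`, for `x ∈ V*` and `g ∈ Γ`. -/
def TensCross.vec (ρ : Representation ℝ Γ V) (x : Module.Dual ℝ V) (g : Γ) : TensCross ρ :=
  SkewMonoidAlgebra.single g (TensV.ι ρ x)

/-- The canonical surjection `T(V*) ⋊ Γ → S(V*) ⋊ Γ`, applied coefficientwise. -/
def TensCross.toSymCross (ρ : Representation ℝ Γ V) (p : TensCross ρ) : SymCross ρ :=
  ⟨p.coeff.mapRange (TensV.toSym ρ) (map_zero _)⟩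

/-! ### Linear Poisson structures on `S(V*) ⋊ Γ` -/

/-- Families `(π_γ)_γ` of bilinear maps `V* × V* → V*`; an alternating one is an element of
`⨁_γ V* ⊗ ⋀² V`. -/
abbrev LinearCochain (Γ V : Type*) [AddCommGroup V] [Module ℝ V] : Type _ :=
  Γ → Module.Dual ℝ V →ₗ[ℝ] Module.Dual ℝ V →ₗ[ℝ] Module.Dual ℝ V

/-- `l(γ)`, the codimension in `V` of the fixed subspace `V^γ`. -/
def codimFix (ρ : Representation ℝ Γ V) (γ : Γ) : ℕ :=
  Module.finrank ℝ (V ⧸ LinearMap.ker (ρ γ - 1))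

/-- `(V^γ)*`, seen in `V*` as the subspace of `γ`-fixed vectors. It is the annihilator of the
complement `N^γ` of `V^γ` (the sum of the nontrivial representations of `⟨γ⟩`). -/
def dualFix (ρ : Representation ℝ Γ V) (γ : Γ) : Submodule ℝ (Module.Dual ℝ V) :=
  LinearMap.ker (ρ.dual γ - 1)

/-- The projection `V* = (V^γ)* ⊕ (N^γ)* → (V^γ)*`, which is the average over the powers of `γ`. -/
def fixProj (ρ : Representation ℝ Γ V) (γ : Γ) : Module.Dual ℝ V →ₗ[ℝ] Module.Dual ℝ V :=
  ((orderOf γ : ℝ)⁻¹) • ∑ k ∈ Finset.range (orderOf γ), (ρ.dual γ) ^ k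

/-- Linear 2-cocycles: the elements of
`(V* ⊗ ⋀² V)^Γ ⊕ (⨁_{l(γ) = 2} (V^γ)* ⊗ ⋀² N^γ)^Γ`. A bivector lies in `⋀² N^γ` iff, as a form
on `V*`, it vanishes as soon as one argument is in the annihilator `(V^γ)*` of `N^γ`. -/
structure IsLinearCocycle (ρ : Representation ℝ Γ V) (π : LinearCochain Γ V) : Prop where
  alternating : ∀ γ x, π γ x x = 0
  invariant : ∀ g γ x y,
    ρ.dual g (π γ (ρ.dual g⁻¹ x) (ρ.dual g⁻¹ y)) = π (g * γ * g⁻¹) x y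
  eq_zero : ∀ γ, codimFix ρ γ ≠ 0 → codimFix ρ γ ≠ 2 → π γ = 0
  value_mem : ∀ γ, codimFix ρ γ = 2 → ∀ x y, π γ x y ∈ dualFix ρ γ
  normal : ∀ γ, codimFix ρ γ = 2 → ∀ x ∈ dualFix ρ γ, ∀ y, π γ x y = 0

/-- `⟦π,π⟧_γ(x₀,x₁,x₂) = ∑_{αβ=γ} π_α(π_β(x₀,x₁), x₂ + ᵝx₂) + cyclic permutations`. -/
def doubleBracket [Fintype Γ] (ρ : Representation ℝ Γ V) (π : LinearCochain Γ V) (γ : Γ)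
    (x : Fin 3 → Module.Dual ℝ V) : Module.Dual ℝ V :=
  ∑ β : Γ,
    (π (γ * β⁻¹) (π β (x 0) (x 1)) (x 2 + ρ.dual β (x 2)) +
      π (γ * β⁻¹) (π β (x 1) (x 2)) (x 0 + ρ.dual β (x 0)) +
      π (γ * β⁻¹) (π β (x 2) (x 0)) (x 1 + ρ.dual β (x 1)))

/-- `pr_γ`, the projection from `V* ⊗ ⋀³ V` to `(V^γ)* ⊗ ⋀^{3-l} V^γ ⊗ ⋀^l N^γ`, `l = l(γ)`
(zero if `l > 3`). On trilinear maps on `V* = (V^γ)* ⊕ (N^γ)*`: keep the terms with exactly `l`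
arguments projected to `(N^γ)*` and the others to `(V^γ)*`, and project the value to `(V^γ)*`. -/
def prFix (ρ : Representation ℝ Γ V) (γ : Γ)
    (T : (Fin 3 → Module.Dual ℝ V) → Module.Dual ℝ V) (x : Fin 3 → Module.Dual ℝ V) :
    Module.Dual ℝ V :=
  fixProj ρ γ (∑ s ∈ Finset.powersetCard (codimFix ρ γ) (Finset.univ : Finset (Fin 3)),
    T fun i => if i ∈ s then x i - fixProj ρ γ (x i) else fixProj ρ γ (x i))

/-- The `γ`-component `[π,π]_γ = pr_γ ∘ ⟦π,π⟧_γ` of the Gerstenhaber bracket. -/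
def gerstenhaber [Fintype Γ] (ρ : Representation ℝ Γ V) (π : LinearCochain Γ V) (γ : Γ) :
    (Fin 3 → Module.Dual ℝ V) → Module.Dual ℝ V :=
  prFix ρ γ (doubleBracket ρ π γ)

/-- Linear Poisson structures on `S(V*) ⋊ Γ`: linear cocycles `π` with `[π,π] = 0`. -/
structure IsLinearPoisson [Fintype Γ] (ρ : Representation ℝ Γ V) (π : LinearCochain Γ V) : Prop
    extends IsLinearCocycle ρ π where
  bracket_eq_zero : ∀ γ x, gerstenhaber ρ π γ x = 0

/-! ### Braverman–Gaitsgory conditions and the PBW property -/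

/-- The Koszul differential `∂_γ(π_γ) ∈ S²(V*) ⊗ ⋀³ V` of the component `π_γ`:
`∑_i (-1)^i π_γ(.., x̂_i, ..)(x_i - ᵞx_i)`. -/
def koszulD (ρ : Representation ℝ Γ V) (π : LinearCochain Γ V) (γ : Γ)
    (x : Fin 3 → Module.Dual ℝ V) : SymV ρ :=
  SymV.ι ρ (π γ (x 1) (x 2)) * SymV.ι ρ (x 0 - ρ.dual γ (x 0)) -
    SymV.ι ρ (π γ (x 0) (x 2)) * SymV.ι ρ (x 1 - ρ.dual γ (x 1)) +
    SymV.ι ρ (π γ (x 0) (x 1)) * SymV.ι ρ (x 2 - ρ.dual γ (x 2))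

/-- The Braverman–Gaitsgory conditions for the relations
`x ⊗ y - y ⊗ x - ∑_γ π_γ(x,y)γ - ∑_γ b_γ(x,y)γ` with constant term `b = 0`: `∂_γ π_γ = 0` and
`⟦π,π⟧_γ = 0` (the value of `∂_γ b_γ`). The third condition, `⟦b,π⟧_γ = 0`, is void for `b = 0`. -/
def BravermanGaitsgory [Fintype Γ] (ρ : Representation ℝ Γ V) (π : LinearCochain Γ V) : Prop :=
  (∀ γ x, koszulD ρ π γ x = 0) ∧ (∀ γ x, doubleBracket ρ π γ x = 0)

/-- The relations `x ⊗ y = y ⊗ x + ∑_γ π_γ(x,y)γ` in `T(V*) ⋊ Γ`. -/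
inductive Rel [Fintype Γ] (ρ : Representation ℝ Γ V) (π : LinearCochain Γ V) :
    TensCross ρ → TensCross ρ → Prop
  | comm (x y : Module.Dual ℝ V) :
      Rel ρ π (TensCross.vec ρ x 1 * TensCross.vec ρ y 1)
        (TensCross.vec ρ y 1 * TensCross.vec ρ x 1 + ∑ γ : Γ, TensCross.vec ρ (π γ x y) γ)

/-- `A_π`, the quotient of `T(V*) ⋊ Γ` by the relations `x ⊗ y - y ⊗ x = ∑_γ π_γ(x,y)γ`. -/
abbrev QuotAlg [Fintype Γ] (ρ : Representation ℝ Γ V) (π : LinearCochain Γ V) : Type _ :=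
  RingQuot (Rel ρ π)

/-- The quotient map `T(V*) ⋊ Γ → A_π`. -/
def QuotAlg.mk [Fintype Γ] (ρ : Representation ℝ Γ V) (π : LinearCochain Γ V) :
    TensCross ρ →ₐ[ℝ] QuotAlg ρ π :=
  RingQuot.mkAlgHom ℝ (Rel ρ π)

/-- The component `T^n(V*) ⊗ ℝΓ` of `T(V*) ⋊ Γ`. -/
def tensDeg (ρ : Representation ℝ Γ V) (n : ℕ) : Submodule ℝ (TensCross ρ) where
  carrier := {p | ∀ g, p.coeff g ∈ LinearMap.range (TensV.ι ρ) ^ n}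
  zero_mem' := fun g => by simp
  add_mem' := fun {p q} hp hq g => by
    rw [SkewMonoidAlgebra.coeff_add, Finsupp.add_apply]
    exact add_mem (hp g) (hq g)
  smul_mem' := fun r p hp g => by
    rw [SkewMonoidAlgebra.coeff_smul, Finsupp.smul_apply]
    exact Submodule.smul_mem _ r (hp g)

/-- The part of `A_π` spanned by the words with fewer than `n` letters in `V*`. -/
def QuotAlg.filtLT [Fintype Γ] (ρ : Representation ℝ Γ V) (π : LinearCochain Γ V) (n : ℕ) :
    Submodule ℝ (QuotAlg ρ π) :=
  (⨆ (k : ℕ) (_ : k < n), tensDeg ρ k).map (QuotAlg.mk ρ π).toLinearMap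

/-- The PBW property `Gr(A_π) ≅ S(V*) ⋊ Γ`: in each degree `n`, the surjection
`T^n(V*) ⊗ ℝΓ → Gr_n(A_π) = F_n / F_{n-1}` has the same kernel as
`T^n(V*) ⊗ ℝΓ → S^n(V*) ⊗ ℝΓ`. -/
def HasPBW [Fintype Γ] (ρ : Representation ℝ Γ V) (π : LinearCochain Γ V) : Prop :=
  ∀ n : ℕ, ∀ p ∈ tensDeg ρ n,
    QuotAlg.mk ρ π p ∈ QuotAlg.filtLT ρ π n ↔ TensCross.toSymCross ρ p = 0

/-! ### Deformation quantization -/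

/-- A formal deformation of an `ℝ`-algebra `A`: a unital associative `ℝ[[ħ]]`-bilinear product
`a ⋆ b = ab + ħ m₁(a,b) + ħ² m₂(a,b) + ⋯` on `A[[ħ]]`, given by its coefficients. -/
structure FormalDeformation (A : Type*) [Ring A] [Algebra ℝ A] where
  m : ℕ → A →ₗ[ℝ] A →ₗ[ℝ] A
  m_zero : ∀ a b, m 0 a b = a * b
  assoc : ∀ (n : ℕ) (a b c : A),
    ∑ ij ∈ Finset.HasAntidiagonal.antidiagonal n, m ij.1 (m ij.2 a b) c =
      ∑ ij ∈ Finset.HasAntidiagonal.antidiagonal n, m ij.1 a (m ij.2 b c)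
  one_left : ∀ n, 1 ≤ n → ∀ a, m n 1 a = 0
  one_right : ∀ n, 1 ≤ n → ∀ a, m n a 1 = 0

/-- The formal deformation `D` of `S(V*) ⋊ Γ` quantizes `π`: the multiplication by elements of `Γ`
is not deformed (so that `m₁` is a Hochschild 2-cocycle relative to `ℝΓ`), and the cocycle
`m₁` restricts to `π` on the Koszul complex, i.e.
`x ⋆ y - y ⋆ x = ħ ∑_γ π_γ(x,y)γ + O(ħ²)` for `x`, `y` in `V*`. -/
structure IsQuantization [Fintype Γ] (ρ : Representation ℝ Γ V) (π : LinearCochain Γ V)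
    (D : FormalDeformation (SymCross ρ)) : Prop where
  group_left : ∀ n, 1 ≤ n → ∀ (g : Γ) (a : SymCross ρ),
    D.m n (SkewMonoidAlgebra.single g 1) a = 0
  group_right : ∀ n, 1 ≤ n → ∀ (g : Γ) (a : SymCross ρ),
    D.m n a (SkewMonoidAlgebra.single g 1) = 0
  first_order : ∀ x y : Module.Dual ℝ V,
    D.m 1 (SymCross.vec ρ x 1) (SymCross.vec ρ y 1) -
        D.m 1 (SymCross.vec ρ y 1) (SymCross.vec ρ x 1) =
      ∑ γ : Γ, SymCross.vec ρ (π γ x y) γ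

/-- The deformation has no correction of order `ħ²` or higher to the commutation relations:
together with `IsQuantization`, `x ⋆ y - y ⋆ x = ħ ∑_γ π_γ(x,y)γ` holds exactly. -/
def NoHigherCorrection (ρ : Representation ℝ Γ V) (D : FormalDeformation (SymCross ρ)) : Prop :=
  ∀ n, 2 ≤ n → ∀ x y : Module.Dual ℝ V,
    D.m n (SymCross.vec ρ x 1) (SymCross.vec ρ y 1) =
      D.m n (SymCross.vec ρ y 1) (SymCross.vec ρ x 1)

end OrbifoldPoisson

end

/-! Condition (1) rests on one vanishing: π_α(π_β(x,y), z + ᵝz) = 0 for all α, β ≠ 1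
(`IsLinearCocycle.apply_apply_add_dual_eq_zero`). Faithfulness and the cocycle conditions leave only
codimension two. Put v = π_β(x,y), which is β-fixed, and suppose the value p is nonzero. As a
two-form on a plane, π_α takes values in the line ℝp, which β preserves because Γ is abelian; since
β has finite order and the scalars are real, it acts there by ±1. If by -1, the symmetrized argument
z + ᵝz kills the term. If by +1, then (α-1)(β-1) = 0 on V*, which forces v to be α-fixed, so
π_α(v,·) = 0. Hence for γ ≠ 1 only the terms with α = 1 or β = 1 survive in ⟦π,π⟧_γ. They form an
alternating trilinear map that vanishes on two γ-fixed arguments by invariance, on one fixed and two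
normal arguments by [π,π]_γ = 0, and on three normal arguments because ⋀³ of a plane is zero
(`IsLinearPoisson.doubleBracket_eq_zero`). For γ = 1 the projection is the identity. The same ⋀³
argument gives ∂_γ(π_γ) = 0.

PBW is a diamond lemma. A linear map `normalOrder` to S(V*) ⋊ Γ is built that kills the ideal of
relations and equals the symbol up to lower degree. A word is sorted by adjacent swaps, each costing
the normal form of an element one degree lower. The result does not depend on the order of swaps if
distant swaps are compatible and the two ways of reversing three letters agree (`sortValue_swap`).
The former follows by induction on the degree, the latter from `IsLinearPoisson.two_smul_jacobi`,
which by (1) writes twice the Jacobi sum in T(V*) ⋊ Γ as a sum of relators.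

For (3), a section of the symbol map averaged over Γ identifies S(V*) ⋊ Γ with A_π. The part of the
transported product that lowers the degree by n is taken as m_n, and associativity is read off
degree by degree. The commutator of x and y is homogeneous of degree 1 = 2 - 1, so it contributes at
order ħ only. -/

noncomputable section

open scoped BigOperators

namespace OrbifoldPoisson

/-! ### Alternating maps modulo a subspace of codimension two -/

section LinearAlgebra

variable {X Y : Type*} [AddCommGroup X] [Module ℝ X] [AddCommGroup Y] [Module ℝ Y]

theorem exists_relation_of_finrank_quotient_eq_two {K : Submodule ℝ X}
    (hK : Module.finrank ℝ (X ⧸ K) = 2) (x y z : X) :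
    ∃ a b c : ℝ, a • x + b • y + c • z ∈ K ∧ (a ≠ 0 ∨ b ≠ 0 ∨ c ≠ 0) := by
  have hfin : FiniteDimensional ℝ (X ⧸ K) := FiniteDimensional.of_finrank_pos (by omega)
  have h : ¬ LinearIndependent ℝ ![K.mkQ x, K.mkQ y, K.mkQ z] := fun h => by
    have := h.fintype_card_le_finrank
    simp [hK] at this
  obtain ⟨g, hg, i, hi⟩ := Fintype.not_linearIndependent_iff.1 h
  refine ⟨g 0, g 1, g 2, ?_, ?_⟩
  · rw [← Submodule.Quotient.mk_eq_zero, ← hg, Fin.sum_univ_three]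
    simp
  · fin_cases i
    · exact Or.inl hi
    · exact Or.inr (Or.inl hi)
    · exact Or.inr (Or.inr hi)

/-- This is ⋀³ = 0 on the plane X/K: three vectors satisfy a nontrivial relation modulo `K`, and an
argument with nonzero coefficient is eliminated. Linearity is asked in the last slot only, since
cyclicity moves any argument there. -/
theorem trilinear_eq_zero_of_finrank_quotient_eq_two {K : Submodule ℝ X}
    (hK : Module.finrank ℝ (X ⧸ K) = 2) (F : X → X → X →ₗ[ℝ] Y)
    (hcyc : ∀ x y z, F x y z = F y z x) (halt : ∀ x z, F x x z = 0)
    (hF : ∀ x y, ∀ z ∈ K, F x y z = 0) (x y z : X) : F x y z = 0 := by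
  have key : ∀ (x y z : X) (a b c : ℝ), c ≠ 0 → a • x + b • y + c • z ∈ K → F x y z = 0 := by
    intro x y z a b c hc h
    have h1 := hF x y _ h
    have h2 : F x y x = 0 := by rw [← hcyc, halt]
    have h3 : F x y y = 0 := by rw [hcyc, halt]
    simpa [h2, h3, hc] using h1
  obtain ⟨a, b, c, h, hne⟩ := exists_relation_of_finrank_quotient_eq_two hK x y z
  rcases hne with ha | hb | hc
  · rw [hcyc]
    exact key y z x b c a ha (by convert h using 1; abel)
  · rw [hcyc, hcyc]
    exact key z x y c a b hb (by convert h using 1; abel)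
  · exact key x y z a b c hc h

variable {B : X →ₗ[ℝ] X →ₗ[ℝ] Y}

theorem neg_of_alternating (hB : ∀ x, B x x = 0) (x y : X) : B x y = -B y x := by
  have h := hB (x + y)
  simp only [map_add, LinearMap.add_apply, hB, zero_add, add_zero] at h
  exact eq_neg_of_add_eq_zero_right h

/-- The form descends to the plane X/K, where `B v z ≠ 0` makes the classes of `v` and `z` a basis.
-/
theorem exists_sub_mem_of_alternating_ne_zero {K : Submodule ℝ X}
    (hK : Module.finrank ℝ (X ⧸ K) = 2) (hB : ∀ x, B x x = 0)
    (hBK : ∀ x ∈ K, ∀ y, B x y = 0) {v z : X} (h : B v z ≠ 0) (x : X) :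
    ∃ a b : ℝ, x - (a • v + b • z) ∈ K := by
  obtain ⟨a, b, c, hm, hne⟩ := exists_relation_of_finrank_quotient_eq_two hK v z x
  have hc : c ≠ 0 := by
    rintro rfl
    -- Pairing the relation with `z` and with `v` would make the other two coefficients vanish as
    -- well.
    have h1 := hBK _ hm z
    have h2 := hBK _ hm v
    simp only [zero_smul, add_zero, map_add, map_smul, LinearMap.add_apply, LinearMap.smul_apply,
      hB, smul_zero, zero_add, smul_eq_zero, h, or_false] at h1 h2
    rw [neg_of_alternating hB, neg_eq_zero] at h2
    simp only [h, or_false] at h2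
    simp [h1, h2] at hne
  refine ⟨-(c⁻¹ * a), -(c⁻¹ * b), ?_⟩
  convert K.smul_mem c⁻¹ hm using 1
  rw [smul_add, smul_add, smul_smul, smul_smul, smul_smul, inv_mul_cancel₀ hc]
  module

/-- A two-form on a plane is a fixed vector times the determinant, so its values fill at most a
line; `r` is the determinant of the coordinates in the basis `v`, `z`. -/
theorem apply_eq_smul_of_alternating_ne_zero {K : Submodule ℝ X}
    (hK : Module.finrank ℝ (X ⧸ K) = 2) (hB : ∀ x, B x x = 0)
    (hBK : ∀ x ∈ K, ∀ y, B x y = 0) {v z : X} (h : B v z ≠ 0) (x y : X) :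
    ∃ r : ℝ, B x y = r • B v z := by
  obtain ⟨a, b, hx⟩ := exists_sub_mem_of_alternating_ne_zero hK hB hBK h x
  obtain ⟨c, d, hy⟩ := exists_sub_mem_of_alternating_ne_zero hK hB hBK h y
  have h1 := hBK _ hx y
  have h2 : B (a • v + b • z) (y - (c • v + d • z)) = 0 := by
    rw [neg_of_alternating hB, hBK _ hy, neg_zero]
  rw [map_sub, LinearMap.sub_apply, sub_eq_zero] at h1
  rw [map_sub, sub_eq_zero] at h2
  refine ⟨a * d - b * c, ?_⟩
  rw [h1, h2]
  simp only [map_add, map_smul, LinearMap.add_apply, LinearMap.smul_apply, hB,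
    neg_of_alternating hB z v]
  module

theorem exists_sub_smul_mem_of_alternating {K : Submodule ℝ X}
    (hK : Module.finrank ℝ (X ⧸ K) = 2) (hB : ∀ x, B x x = 0)
    (hBK : ∀ x ∈ K, ∀ y, B x y = 0) {v z : X} (h : B v z ≠ 0) {w : X} (hw : B v w = 0) :
    ∃ a : ℝ, w - a • v ∈ K := by
  obtain ⟨a, b, hx⟩ := exists_sub_mem_of_alternating_ne_zero hK hB hBK h w
  have h1 := hBK _ hx v
  rw [neg_of_alternating hB] at h1
  simp only [map_sub, hw, map_add, map_smul, hB, smul_zero, zero_add, zero_sub, neg_neg,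
    smul_eq_zero, h, or_false] at h1
  exact ⟨a, by simpa [h1] using hx⟩

end LinearAlgebra

/-! ### The Braverman–Gaitsgory conditions for abelian groups -/

section Group

variable {Γ V : Type*} [Group Γ] [AddCommGroup V] [Module ℝ V] {ρ : Representation ℝ Γ V}

theorem mem_dualFix_iff {γ : Γ} {x : Module.Dual ℝ V} : x ∈ dualFix ρ γ ↔ ρ.dual γ x = x := by
  simp [dualFix, sub_eq_zero]

theorem ker_sub_one_inv (γ : Γ) : LinearMap.ker (ρ γ⁻¹ - 1) = LinearMap.ker (ρ γ - 1) := by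
  ext v
  simp only [LinearMap.mem_ker, LinearMap.sub_apply, Module.End.one_apply, sub_eq_zero]
  constructor
  · intro h
    nth_rewrite 1 [← h]
    rw [← Module.End.mul_apply, ← map_mul, mul_inv_cancel, map_one, Module.End.one_apply]
  · intro h
    nth_rewrite 1 [← h]
    rw [← Module.End.mul_apply, ← map_mul, inv_mul_cancel, map_one, Module.End.one_apply]

/-- The operator γ - 1 on V* is the transpose of γ⁻¹ - 1 on V; transposes have equal rank, and γ⁻¹
has the same fixed vectors as γ. -/
theorem finrank_quotient_dualFix [FiniteDimensional ℝ V] (γ : Γ) :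
    Module.finrank ℝ (Module.Dual ℝ V ⧸ dualFix ρ γ) = codimFix ρ γ := by
  have h : ρ.dual γ - 1 = (ρ γ⁻¹ - 1).dualMap := by
    ext f v
    simp [Module.Dual.transpose]
  rw [dualFix, codimFix, h, (LinearMap.quotKerEquivRange _).finrank_eq,
    LinearMap.finrank_range_dualMap_eq_finrank_range, ← ker_sub_one_inv,
    (LinearMap.quotKerEquivRange _).finrank_eq]

theorem codimFix_one : codimFix ρ 1 = 0 := by
  rw [codimFix, map_one, sub_self, LinearMap.ker_zero, Module.finrank_eq_zero_of_subsingleton]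

/-- Faithfulness enters through this lemma: a component of a cocycle at γ ≠ 1 can be nonzero only in
codimension exactly two. -/
theorem codimFix_ne_zero [FiniteDimensional ℝ V] (hρ : Function.Injective ρ) {γ : Γ}
    (hγ : γ ≠ 1) : codimFix ρ γ ≠ 0 := by
  intro h
  apply hγ
  apply hρ
  rw [codimFix, Module.finrank_zero_iff, Submodule.Quotient.subsingleton_iff,
    LinearMap.ker_eq_top, sub_eq_zero] at h
  rw [h, map_one]

theorem dual_mul_apply (g h : Γ) (x : Module.Dual ℝ V) :
    ρ.dual (g * h) x = ρ.dual g (ρ.dual h x) := by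
  rw [map_mul, Module.End.mul_apply]

theorem dual_pow_apply_of_mem_dualFix {γ : Γ} {x : Module.Dual ℝ V} (hx : x ∈ dualFix ρ γ)
    (k : ℕ) : ((ρ.dual γ) ^ k) x = x := by
  induction k with
  | zero => simp
  | succ k ih => rw [pow_succ, Module.End.mul_apply, mem_dualFix_iff.1 hx, ih]

/-- The sum telescopes around the cycle of powers of γ. -/
theorem sum_dual_pow_sub [Finite Γ] (γ : Γ) (x : Module.Dual ℝ V) :
    ∑ k ∈ Finset.range (orderOf γ), ((ρ.dual γ) ^ k) (ρ.dual γ x - x) = 0 := by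
  have h : ∀ k, ((ρ.dual γ) ^ k) (ρ.dual γ x - x) =
      ((ρ.dual γ) ^ (k + 1)) x - ((ρ.dual γ) ^ k) x := fun k => by
    rw [map_sub, pow_succ, Module.End.mul_apply]
  rw [Finset.sum_congr rfl fun k _ => h k,
    Finset.sum_range_sub (fun k => ((ρ.dual γ) ^ k) x), ← map_pow, pow_orderOf_eq_one, map_one,
    pow_zero, sub_self]

theorem fixProj_mem_dualFix [Finite Γ] (γ : Γ) (x : Module.Dual ℝ V) :
    fixProj ρ γ x ∈ dualFix ρ γ := by
  rw [mem_dualFix_iff, ← sub_eq_zero, fixProj]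
  have h := sum_dual_pow_sub (ρ := ρ) γ x
  simp only [map_sub, Finset.sum_sub_distrib] at h
  have hs : ∀ k, ((ρ.dual γ) ^ k) (ρ.dual γ x) = ρ.dual γ (((ρ.dual γ) ^ k) x) := fun k => by
    rw [← Module.End.mul_apply, ← pow_succ, pow_succ', Module.End.mul_apply]
  rw [sub_eq_zero] at h ⊢
  simp only [LinearMap.smul_apply, LinearMap.sum_apply, map_smul, map_sum, ← hs, h]

theorem fixProj_of_mem_dualFix [Finite Γ] {γ : Γ} {x : Module.Dual ℝ V} (hx : x ∈ dualFix ρ γ) :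
    fixProj ρ γ x = x := by
  have h : (orderOf γ : ℝ) ≠ 0 := by exact_mod_cast (orderOf_pos γ).ne'
  rw [fixProj, LinearMap.smul_apply, LinearMap.sum_apply,
    Finset.sum_congr rfl fun k _ => dual_pow_apply_of_mem_dualFix hx k]
  rw [Finset.sum_const, Finset.card_range, ← Nat.cast_smul_eq_nsmul ℝ, smul_smul,
    inv_mul_cancel₀ h, one_smul]

theorem IsLinearCocycle.neg {π : LinearCochain Γ V} (hπ : IsLinearCocycle ρ π) (γ : Γ)
    (x y : Module.Dual ℝ V) : π γ x y = -π γ y x :=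
  neg_of_alternating (hπ.alternating γ) x y

theorem IsLinearCocycle.eq_zero_right {π : LinearCochain Γ V} (hπ : IsLinearCocycle ρ π) {γ : Γ}
    (hγ : codimFix ρ γ = 2) (x : Module.Dual ℝ V) {y : Module.Dual ℝ V} (hy : y ∈ dualFix ρ γ) :
    π γ x y = 0 := by
  rw [hπ.neg, hπ.normal γ hγ y hy, neg_zero]

end Group

section CommGroup

variable {Γ V : Type*} [CommGroup Γ] [AddCommGroup V] [Module ℝ V]
  {ρ : Representation ℝ Γ V} {π : LinearCochain Γ V}

theorem dual_comm (g h : Γ) (x : Module.Dual ℝ V) :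
    ρ.dual g (ρ.dual h x) = ρ.dual h (ρ.dual g x) := by
  rw [← dual_mul_apply, mul_comm, dual_mul_apply]

theorem dual_mem_dualFix {γ : Γ} (g : Γ) {x : Module.Dual ℝ V} (hx : x ∈ dualFix ρ γ) :
    ρ.dual g x ∈ dualFix ρ γ := by
  rw [mem_dualFix_iff] at hx ⊢
  rw [dual_comm, hx]

/-- Conjugation is trivial in an abelian group, so each component is by itself equivariant under all
of Γ. -/
theorem IsLinearCocycle.dual_apply (hπ : IsLinearCocycle ρ π) (g γ : Γ)
    (x y : Module.Dual ℝ V) : ρ.dual g (π γ x y) = π γ (ρ.dual g x) (ρ.dual g y) := by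
  have h := hπ.invariant g γ (ρ.dual g x) (ρ.dual g y)
  rwa [← dual_mul_apply, ← dual_mul_apply, inv_mul_cancel, map_one, Module.End.one_apply,
    Module.End.one_apply, mul_comm g, mul_assoc, mul_inv_cancel, mul_one] at h

/-- Finite order makes the eigenvalue a root of unity, and the real ones are ±1. -/
theorem real_eq_or_eq_neg_of_dual [Finite Γ] {g : Γ} {p : Module.Dual ℝ V} (hp : p ≠ 0) {c : ℝ}
    (h : ρ.dual g p = c • p) : c = 1 ∨ c = -1 := by
  have hk : ∀ k : ℕ, ((ρ.dual g) ^ k) p = c ^ k • p := by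
    intro k
    induction k with
    | zero => simp
    | succ k ih => rw [pow_succ, Module.End.mul_apply, h, map_smul, ih, smul_smul, pow_succ']
  have h1 := hk (orderOf g)
  rw [← map_pow, pow_orderOf_eq_one, map_one, Module.End.one_apply] at h1
  have h2 : (1 - c ^ orderOf g) • p = 0 := by
    have h3 : (1 - c ^ orderOf g) • p = p - c ^ orderOf g • p := by module
    rw [h3, ← h1, sub_self]
  have h3 : c ^ orderOf g = 1 := by
    rcases smul_eq_zero.1 h2 with h | h
    · linarith
    · exact absurd h hp
  have h4 : |c| = 1 := by
    have : |c| ^ orderOf g = 1 := by rw [← abs_pow, h3, abs_one]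
    exact (pow_eq_one_iff_of_nonneg (abs_nonneg c) (orderOf_pos g).ne').1 this
  exact eq_or_eq_neg_of_abs_eq h4

/-- Summing over the powers of β kills ᵝw - w and multiplies the fixed vector `v` by the order of β.
A nonzero `a` would thus put `v` among the α-fixed vectors. -/
theorem sub_mem_dualFix_of_sub_smul_mem [Finite Γ] {α β : Γ} {v w : Module.Dual ℝ V}
    (hv : v ∈ dualFix ρ β) (hv' : v ∉ dualFix ρ α) {a : ℝ}
    (h : ρ.dual β w - w - a • v ∈ dualFix ρ α) : ρ.dual β w - w ∈ dualFix ρ α := by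
  have hpow : ∀ k : ℕ, ((ρ.dual β) ^ k) (ρ.dual β w - w) - a • v ∈ dualFix ρ α := fun k => by
    have := dual_mem_dualFix (β ^ k) h
    rwa [map_sub, map_pow, map_smul, dual_pow_apply_of_mem_dualFix hv] at this
  have hsum := Submodule.sum_mem _ fun k (_ : k ∈ Finset.range (orderOf β)) => hpow k
  rw [Finset.sum_sub_distrib, sum_dual_pow_sub, zero_sub, Finset.sum_const, Finset.card_range,
    ← Nat.cast_smul_eq_nsmul ℝ, smul_smul, neg_mem_iff] at hsum
  have h0 : (orderOf β : ℝ) ≠ 0 := by exact_mod_cast (orderOf_pos β).ne'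
  by_cases ha : a = 0
  · simpa [ha] using h
  · exact absurd ((Submodule.smul_mem_iff _ (mul_ne_zero h0 ha)).1 hsum) hv'

theorem IsLinearCocycle.apply_apply_add_dual_eq_zero [Finite Γ] [FiniteDimensional ℝ V]
    (hπ : IsLinearCocycle ρ π) {α β : Γ} (hα : codimFix ρ α = 2) (hβ : codimFix ρ β = 2)
    (x y z : Module.Dual ℝ V) : π α (π β x y) (z + ρ.dual β z) = 0 := by
  by_contra hne
  have hK := (finrank_quotient_dualFix (ρ := ρ) α).trans hα
  have hB := hπ.alternating α
  have hBK := hπ.normal α hα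
  have hv := hπ.value_mem β hβ x y
  have hv' : π β x y ∉ dualFix ρ α := fun h => hne (hBK _ h _)
  set v := π β x y with hvdef
  set p := π α v (z + ρ.dual β z) with hp
  -- As `v` is β-fixed, equivariance of π_α makes π_α(v,·) commute with β; hence β preserves the
  -- line of values and acts on it by a scalar `c`.
  have hφ : ∀ w, ρ.dual β (π α v w) = π α v (ρ.dual β w) := fun w => by
    rw [hπ.dual_apply, mem_dualFix_iff.1 hv]
  obtain ⟨c, hc⟩ := apply_eq_smul_of_alternating_ne_zero hK hB hBK hne v
    (ρ.dual β (z + ρ.dual β z))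
  rw [← hφ, ← hp] at hc
  have hall : ∀ w, π α v (ρ.dual β w) = c • π α v w := fun w => by
    obtain ⟨r, hr⟩ := apply_eq_smul_of_alternating_ne_zero hK hB hBK hne v w
    rw [← hφ, hr, ← hp, map_smul, hc, smul_comm]
  rcases real_eq_or_eq_neg_of_dual hne hc with rfl | rfl
  -- Case c = 1: π_α(v,·) kills ᵝw - w, which therefore lies in ℝv plus the α-fixed vectors;
  -- averaging removes the multiple of `v`.
  · have hαβ : ∀ w, ρ.dual β w - w ∈ dualFix ρ α := fun w => by
      obtain ⟨a, ha⟩ := exists_sub_smul_mem_of_alternating hK hB hBK hne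
        (w := ρ.dual β w - w) (by rw [map_sub, hall, one_smul, sub_self])
      exact sub_mem_dualFix_of_sub_smul_mem hv hv' ha
    -- The previous fact reads (α-1)(β-1) = 0, and the two factors commute.
    have hβα : ∀ w, ρ.dual α w - w ∈ dualFix ρ β := fun w => by
      have := mem_dualFix_iff.1 (hαβ w)
      rw [map_sub, sub_eq_sub_iff_add_eq_add] at this
      rw [mem_dualFix_iff, map_sub, dual_comm, sub_eq_sub_iff_add_eq_add, this, add_comm]
    -- π_β sees its arguments only modulo β-fixed vectors, and ᵅx, ᵅy agree with x, y modulo those.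
    -- So α fixes v = π_β(x,y), a contradiction.
    apply hv'
    rw [mem_dualFix_iff, hvdef, hπ.dual_apply]
    have h1 := hπ.normal β hβ _ (hβα x) (ρ.dual α y)
    have h2 := hπ.eq_zero_right hβ x (hβα y)
    rw [map_sub, LinearMap.sub_apply, sub_eq_zero] at h1
    rw [map_sub, sub_eq_zero] at h2
    rw [h1, h2]
  -- Case c = -1: the contributions of z and ᵝz cancel.
  · apply hne
    rw [hp, map_add, hall]
    module

variable [Fintype Γ] [FiniteDimensional ℝ V]

theorem IsLinearCocycle.apply_apply_add_dual_eq_zero_of_ne_one (hρ : Function.Injective ρ)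
    (hπ : IsLinearCocycle ρ π) {α β : Γ} (hα : α ≠ 1) (hβ : β ≠ 1)
    (x y z : Module.Dual ℝ V) : π α (π β x y) (z + ρ.dual β z) = 0 := by
  by_cases h2 : codimFix ρ α = 2
  · by_cases h3 : codimFix ρ β = 2
    · exact hπ.apply_apply_add_dual_eq_zero h2 h3 x y z
    · simp [hπ.eq_zero β (codimFix_ne_zero hρ hβ) h3]
  · simp [hπ.eq_zero α (codimFix_ne_zero hρ hα) h2]

/-- The sum of the two mixed terms of `⟦π,π⟧_γ`, before cyclic symmetrization. -/
def mixedTerm (ρ : Representation ℝ Γ V) (π : LinearCochain Γ V) (γ : Γ)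
    (x y : Module.Dual ℝ V) : Module.Dual ℝ V →ₗ[ℝ] Module.Dual ℝ V :=
  π γ (π 1 x y) ∘ₗ (LinearMap.id + LinearMap.id) + π 1 (π γ x y) ∘ₗ (LinearMap.id + ρ.dual γ)

omit [Fintype Γ] [FiniteDimensional ℝ V] in
theorem mixedTerm_apply (γ : Γ) (x y z : Module.Dual ℝ V) :
    mixedTerm ρ π γ x y z = π γ (π 1 x y) (z + z) + π 1 (π γ x y) (z + ρ.dual γ z) := rfl

/-- Apart from β = 1 and β = γ, every factorization αβ = γ has both factors nontrivial and
contributes nothing. -/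
theorem IsLinearCocycle.doubleBracket_eq_mixedTerm (hρ : Function.Injective ρ)
    (hπ : IsLinearCocycle ρ π) {γ : Γ} (hγ : γ ≠ 1) (x : Fin 3 → Module.Dual ℝ V) :
    doubleBracket ρ π γ x = mixedTerm ρ π γ (x 0) (x 1) (x 2) +
      mixedTerm ρ π γ (x 1) (x 2) (x 0) + mixedTerm ρ π γ (x 2) (x 0) (x 1) := by
  classical
  rw [doubleBracket, ← Finset.sum_subset (Finset.subset_univ ({1, γ} : Finset Γ)),
    Finset.sum_pair hγ.symm]
  · simp only [mixedTerm_apply, inv_one, mul_one, mul_inv_cancel, map_one, Module.End.one_apply]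
    abel
  · intro β _ hβ
    simp only [Finset.mem_insert, Finset.mem_singleton, not_or] at hβ
    have h : γ * β⁻¹ ≠ 1 := fun h => hβ.2 (mul_inv_eq_one.1 h).symm
    simp only [hπ.apply_apply_add_dual_eq_zero_of_ne_one hρ h hβ.1, add_zero]

theorem powersetCard_two_fin_three :
    Finset.powersetCard 2 (Finset.univ : Finset (Fin 3)) = {{0, 1}, {0, 2}, {1, 2}} := by
  decide

/-- The projection in the definition of [π,π]_γ loses nothing: every component of ⟦π,π⟧_γ that it
discards vanishes automatically. -/
theorem IsLinearPoisson.doubleBracket_eq_zero (hρ : Function.Injective ρ)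
    (hπ : IsLinearPoisson ρ π) (γ : Γ) (x : Fin 3 → Module.Dual ℝ V) :
    doubleBracket ρ π γ x = 0 := by
  have hc := hπ.toIsLinearCocycle
  rcases eq_or_ne γ 1 with rfl | hγ
  · have h := hπ.bracket_eq_zero 1 x
    have hP : ∀ y : Module.Dual ℝ V, fixProj ρ 1 y = y := fun y =>
      fixProj_of_mem_dualFix (by rw [mem_dualFix_iff, map_one, Module.End.one_apply])
    simpa [gerstenhaber, prFix, codimFix_one, hP] using h
  by_cases h2 : codimFix ρ γ = 2
  swap
  · rw [hc.doubleBracket_eq_mixedTerm hρ hγ]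
    simp [mixedTerm_apply, hc.eq_zero γ (codimFix_ne_zero hρ hγ) h2]
  have hmem1 : ∀ f ∈ dualFix ρ γ, ∀ f' ∈ dualFix ρ γ, π 1 f f' ∈ dualFix ρ γ :=
    fun f hf f' hf' => by
      rw [mem_dualFix_iff, hc.dual_apply, mem_dualFix_iff.1 hf, mem_dualFix_iff.1 hf']
  have hnorm := hc.normal γ h2
  have hval := hc.value_mem γ h2
  have hright : ∀ x, ∀ y ∈ dualFix ρ γ, π γ x y = 0 := fun x y hy => hc.eq_zero_right h2 x hy
  let F : Module.Dual ℝ V → Module.Dual ℝ V → Module.Dual ℝ V →ₗ[ℝ] Module.Dual ℝ V :=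
    fun x y =>
      { toFun := fun z => mixedTerm ρ π γ x y z + mixedTerm ρ π γ y z x + mixedTerm ρ π γ z x y
        map_add' := fun z z' => by
          simp only [mixedTerm_apply, map_add, LinearMap.add_apply]; abel
        map_smul' := fun r z => by
          simp only [mixedTerm_apply, map_smul, LinearMap.smul_apply, smul_add, map_add,
            RingHom.id_apply] }
  have hFdef : ∀ x y z, F x y z =
      mixedTerm ρ π γ x y z + mixedTerm ρ π γ y z x + mixedTerm ρ π γ z x y := fun _ _ _ => rfl
  have hbr : ∀ x, doubleBracket ρ π γ x = F (x 0) (x 1) (x 2) := fun x => by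
    rw [hc.doubleBracket_eq_mixedTerm hρ hγ, hFdef]
  have hcyc : ∀ x y z, F x y z = F y z x := fun x y z => by simp only [hFdef]; abel
  have halt : ∀ x z, F x x z = 0 := fun x z => by
    rw [hFdef]
    simp only [mixedTerm_apply, hc.alternating, map_zero, LinearMap.zero_apply, add_zero, zero_add,
      hc.neg 1 z x, hc.neg γ z x, map_neg, LinearMap.neg_apply]
    abel
  -- Two fixed arguments: π_γ annihilates fixed vectors, and π_1 of two of them is again fixed by
  -- equivariance.
  have hFF : ∀ f ∈ dualFix ρ γ, ∀ f' ∈ dualFix ρ γ, ∀ z, F f f' z = 0 := by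
    intro f hf f' hf' z
    simp [hFdef, mixedTerm_apply, hnorm f hf, hnorm f' hf', hright _ f hf, hright _ f' hf',
      hnorm _ (hmem1 f hf f' hf')]
  have hFN : ∀ f ∈ dualFix ρ γ, ∀ y z, F f (y - fixProj ρ γ y) (z - fixProj ρ γ z) = 0 := by
    intro f hf y z
    have hb := hπ.bracket_eq_zero γ ![f, y, z]
    have hz : ∀ y z, F 0 y z = 0 := fun y z => by rw [hcyc, map_zero]
    -- Among the three choices of two normal slots, the two that include the slot of `f` vanish
    -- because `f` has no normal part.
    rw [gerstenhaber, prFix, h2, powersetCard_two_fin_three, Finset.sum_insert (by decide),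
      Finset.sum_pair (by decide), hbr, hbr, hbr] at hb
    simp only [Matrix.cons_val_zero, Matrix.cons_val_one, Matrix.cons_val, Finset.mem_insert,
      Finset.mem_singleton, fixProj_of_mem_dualFix hf, true_or, or_true, if_true, sub_self, hz,
      zero_add, Fin.isValue, zero_ne_one, Fin.reduceEq, or_self, if_false] at hb
    rwa [fixProj_of_mem_dualFix] at hb
    -- It remains to see that the value is already γ-fixed, so that the outer projection does not
    -- change it.
    have h1 := hmem1 _ (hval (y - fixProj ρ γ y) (z - fixProj ρ γ z)) _
      (add_mem hf (dual_mem_dualFix γ hf))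
    simp only [hFdef, mixedTerm_apply, hnorm f hf, hright _ f hf, map_zero, LinearMap.zero_apply,
      add_zero]
    exact add_mem (add_mem (hval _ _) (add_mem (hright _ _ (add_mem hf hf) ▸ zero_mem _) h1))
      (hval _ _)
  -- The other two arguments are split into fixed and normal parts, reducing to the two cases above.
  have hK : ∀ x y, ∀ z ∈ dualFix ρ γ, F x y z = 0 := by
    intro x y z hz
    have hsub : ∀ y y' w, F z (y - y') w = F z y w - F z y' w := fun y y' w => by
      rw [hcyc, hcyc, map_sub, hcyc w z y, hcyc w z y']
    have h1 : ∀ w, F z (fixProj ρ γ x) w = 0 := hFF z hz _ (fixProj_mem_dualFix γ x)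
    have h2 : ∀ w, F z w (fixProj ρ γ y) = 0 := fun w => by
      rw [hcyc, hcyc]
      exact hFF _ (fixProj_mem_dualFix γ y) z hz w
    have h3 := hFN z hz x y
    rw [map_sub, hsub, hsub, h1, h1, h2, sub_zero, sub_zero, sub_zero] at h3
    rwa [← hcyc]
  rw [hbr]
  exact trilinear_eq_zero_of_finrank_quotient_eq_two
    ((finrank_quotient_dualFix (ρ := ρ) γ).trans h2) F hcyc halt hK _ _ _

omit [Fintype Γ] in
-- The sum is alternating and depends only on the arguments modulo γ-fixed vectors, a plane when π_γ
-- ≠ 0 and γ ≠ 1. The pairing `Q` is arbitrary because it serves twice: as the product of S(V*) for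
-- the Koszul condition, and as the symmetrized product of T(V*) ⋊ Γ for the Jacobi identity.
theorem IsLinearCocycle.cyclic_sum_eq_zero (hρ : Function.Injective ρ)
    (hπ : IsLinearCocycle ρ π) {Y : Type*} [AddCommGroup Y] [Module ℝ Y]
    (Q : Module.Dual ℝ V →ₗ[ℝ] Module.Dual ℝ V →ₗ[ℝ] Y) (γ : Γ) (x y z : Module.Dual ℝ V) :
    Q (π γ x y) (z - ρ.dual γ z) + Q (π γ y z) (x - ρ.dual γ x) +
      Q (π γ z x) (y - ρ.dual γ y) = 0 := by
  rcases eq_or_ne γ 1 with rfl | hγ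
  · simp only [map_one, Module.End.one_apply, sub_self, map_zero, add_zero]
  by_cases h2 : codimFix ρ γ = 2
  swap
  · simp [hπ.eq_zero γ (codimFix_ne_zero hρ hγ) h2]
  let F : Module.Dual ℝ V → Module.Dual ℝ V → Module.Dual ℝ V →ₗ[ℝ] Y := fun x y =>
    { toFun := fun z => Q (π γ x y) (z - ρ.dual γ z) + Q (π γ y z) (x - ρ.dual γ x) +
        Q (π γ z x) (y - ρ.dual γ y)
      map_add' := fun z z' => by
        simp only [map_sub, map_add, LinearMap.add_apply]; abel
      map_smul' := fun r z => by
        simp only [map_sub, map_smul, LinearMap.smul_apply, smul_add, smul_sub,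
          RingHom.id_apply] }
  refine trilinear_eq_zero_of_finrank_quotient_eq_two
    ((finrank_quotient_dualFix (ρ := ρ) γ).trans h2) F (fun x y z => ?_) (fun x z => ?_)
    (fun x y z hz => ?_) x y z
  · simp only [F, LinearMap.coe_mk, AddHom.coe_mk]
    abel
  · simp only [F, LinearMap.coe_mk, AddHom.coe_mk, hπ.alternating, hπ.neg γ z x, map_zero,
      map_neg, LinearMap.zero_apply, LinearMap.neg_apply]
    abel
  · simp only [F, LinearMap.coe_mk, AddHom.coe_mk, mem_dualFix_iff.1 hz, sub_self, map_zero,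
      hπ.normal γ h2 z hz, hπ.eq_zero_right h2 _ hz, LinearMap.zero_apply, add_zero]

theorem IsLinearPoisson.bravermanGaitsgory (hρ : Function.Injective ρ)
    (hπ : IsLinearPoisson ρ π) : BravermanGaitsgory ρ π := by
  refine ⟨fun γ x => ?_, hπ.doubleBracket_eq_zero hρ⟩
  have h := hπ.toIsLinearCocycle.cyclic_sum_eq_zero hρ
    ((LinearMap.mul ℝ (SymV ρ)).compl₁₂ (SymV.ι ρ) (SymV.ι ρ)) γ (x 0) (x 1) (x 2)
  simp only [LinearMap.compl₁₂_apply, LinearMap.mul_apply'] at h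
  rw [koszulD, hπ.toIsLinearCocycle.neg γ (x 0) (x 2), map_neg, ← h]
  ring

end CommGroup

/-! ### Sorting words: the diamond lemma for adjacent transpositions -/

section Sorting

variable {κ : Type*} [LinearOrder κ]

/-- The number of inversions of a word. -/
def inversions : List κ → ℕ
  | [] => 0
  | x :: w => w.countP (· < x) + inversions w

theorem inversions_swap_lt (l r : List κ) {a b : κ} (h : a < b) :
    inversions (l ++ a :: b :: r) < inversions (l ++ b :: a :: r) := by
  induction l with
  | nil =>
    simp only [List.nil_append, inversions, List.countP_cons, h, h.not_gt, decide_true,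
      decide_false, if_true]
    simp
    omega
  | cons x l ih =>
    have hp : (l ++ a :: b :: r).Perm (l ++ b :: a :: r) :=
      List.Perm.append_left l (List.Perm.swap b a r)
    simp only [List.cons_append, inversions, hp.countP_eq]
    omega

/-- `w = l ++ b :: a :: r` has a descent `a < b`. -/
def IsDescent (w l : List κ) (b a : κ) (r : List κ) : Prop :=
  w = l ++ b :: a :: r ∧ a < b

variable {M : Type*} [AddCommGroup M]

open Classical in
/-- The value of a word, where sorted words have the value `base` and the replacement of `b a` by
`a b` with `a < b` costs `D`. -/
def sortValue (D : List κ → κ → κ → List κ → M) (base : List κ → M) (w : List κ) : M :=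
  if h : ∃ l b a r, IsDescent w l b a r then
    sortValue D base (h.choose ++ h.choose_spec.choose_spec.choose ::
      h.choose_spec.choose :: h.choose_spec.choose_spec.choose_spec.choose) +
      D h.choose h.choose_spec.choose h.choose_spec.choose_spec.choose
        h.choose_spec.choose_spec.choose_spec.choose
  else base w
termination_by inversions w
decreasing_by
  have hs := h.choose_spec.choose_spec.choose_spec.choose_spec
  conv_rhs => rw [hs.1]
  exact inversions_swap_lt _ _ hs.2

variable {D : List κ → κ → κ → List κ → M} {base : List κ → M}

theorem sortValue_of_sorted {w : List κ} (h : ∀ l b a r, ¬ IsDescent w l b a r) :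
    sortValue D base w = base w := by
  rw [sortValue, dif_neg]
  rintro ⟨l, b, a, r, h'⟩
  exact h l b a r h'

theorem exists_sortValue_eq {w : List κ} (h : ∃ l b a r, IsDescent w l b a r) :
    ∃ l b a r, IsDescent w l b a r ∧
      sortValue D base w = sortValue D base (l ++ a :: b :: r) + D l b a r := by
  refine ⟨_, _, _, _, h.choose_spec.choose_spec.choose_spec.choose_spec, ?_⟩
  rw [sortValue, dif_pos h]

/-- `sortValue` makes an arbitrary choice of descent; this shows that the choice is immaterial. By
induction on inversions, two first swaps lead to words for which the statement is known, and these
can be brought to a common word: distant swaps commute, and overlapping ones close up by the hexagon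
`hbraid`. -/
theorem sortValue_swap {n : ℕ}
    (hdisj : ∀ l b a m d c r, a < b → c < d → (l ++ b :: a :: (m ++ d :: c :: r)).length = n →
      D l b a (m ++ d :: c :: r) + D (l ++ a :: b :: m) d c r =
        D (l ++ b :: a :: m) d c r + D l b a (m ++ c :: d :: r))
    (hbraid : ∀ l c b a r, a < b → b < c → (l ++ c :: b :: a :: r).length = n →
      D l c b (a :: r) + D (l ++ [b]) c a r + D l b a (c :: r) =
        D (l ++ [c]) b a r + D l c a (b :: r) + D (l ++ [a]) c b r)
    (l : List κ) (b a : κ) (r : List κ) (h : a < b) (hn : (l ++ b :: a :: r).length = n) :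
    sortValue D base (l ++ b :: a :: r) = sortValue D base (l ++ a :: b :: r) + D l b a r := by
  obtain ⟨N, hN⟩ : ∃ N, inversions (l ++ b :: a :: r) = N := ⟨_, rfl⟩
  induction N using Nat.strong_induction_on generalizing l b a r with
  | _ N ih =>
  subst hN
  -- Local confluence for two descents of one word, the first not to the right of the second; `m`
  -- will be the stretch between their starting points.
  have key : ∀ l b a r l' b' a' r', a < b → a' < b' → l.length ≤ l'.length →
      (l ++ b :: a :: r).length = n →
      l ++ b :: a :: r = l' ++ b' :: a' :: r' →
      (∀ l₁ b₁ a₁ r₁, a₁ < b₁ → (l₁ ++ b₁ :: a₁ :: r₁).length = n →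
        inversions (l₁ ++ b₁ :: a₁ :: r₁) < inversions (l ++ b :: a :: r) →
        sortValue D base (l₁ ++ b₁ :: a₁ :: r₁) =
          sortValue D base (l₁ ++ a₁ :: b₁ :: r₁) + D l₁ b₁ a₁ r₁) →
      sortValue D base (l ++ a :: b :: r) + D l b a r =
        sortValue D base (l' ++ a' :: b' :: r') + D l' b' a' r' := by
    clear ih h hn l b a r
    intro l b a r l' b' a' r' h h' hle hn heq ih
    have hlt : ∀ l r {a b : κ}, a < b → inversions (l ++ a :: b :: r) <
      inversions (l ++ b :: a :: r) := fun l r _ _ h => inversions_swap_lt l r h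
    obtain ⟨m, rfl⟩ : ∃ m, l' = l ++ m :=
      ⟨l'.drop l.length, by
        have := congrArg (List.take l.length) heq
        rw [List.take_left', List.take_append_of_le_length hle] at this
        · rw [this, List.length_take, min_eq_left hle, List.take_append_drop]
        · rfl⟩
    rw [List.append_assoc, List.append_cancel_left_eq] at heq
    match m, heq with
    | [], heq =>
      simp only [List.nil_append, List.cons.injEq] at heq
      obtain ⟨rfl, rfl, rfl⟩ := heq
      simp
    -- Overlapping descents b > a > a': each side takes two more swaps to reach the word with a', a,
    -- b in order, and `hbraid` equates the total costs.
    | [x], heq =>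
      simp only [List.cons_append, List.nil_append, List.cons.injEq] at heq
      obtain ⟨rfl, rfl, rfl⟩ := heq
      have i1 := hlt (l ++ [a]) r' (h'.trans h)
      have i2 := hlt (l ++ [b]) r' h'
      simp only [List.append_assoc, List.cons_append, List.nil_append] at i1 i2
      have e1 := ih (l ++ [a]) b a' r' (h'.trans h) (by simpa using hn)
        (by simpa using hlt l (a' :: r') h)
      have e2 := ih l a a' (b :: r') h' (by simpa using hn) (i1.trans (hlt l (a' :: r') h))
      have e3 := ih l b a' (a :: r') (h'.trans h) (by simpa using hn) i2
      have e4 := ih (l ++ [a']) b a r' h (by simpa using hn)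
        (by simpa using (hlt l (a :: r') (h'.trans h)).trans i2)
      have e5 := hbraid l b a a' r' h' h hn
      simp only [List.append_assoc, List.cons_append, List.nil_append] at e1 e2 e3 e4 ⊢
      rw [e1, e2, e3, e4, add_assoc, add_assoc, add_assoc, add_assoc]
      congr 1
      rw [← sub_eq_zero] at e5 ⊢
      rw [← e5]
      abel
    -- Disjoint descents: performing the other swap on each side leads to the same word.
    | x :: y :: m, heq =>
      simp only [List.cons_append, List.cons.injEq] at heq
      obtain ⟨rfl, rfl, rfl⟩ := heq
      have e1 := ih (l ++ a :: b :: m) b' a' r' h' (by simpa using hn)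
        (by simpa using hlt l (m ++ b' :: a' :: r') h)
      have e2 := ih l b a (m ++ a' :: b' :: r') h (by simpa using hn)
        (by simpa using hlt (l ++ b :: a :: m) r' h')
      have e3 := hdisj l b a m b' a' r' h h' hn
      simp only [List.append_assoc, List.cons_append] at e1 e2 ⊢
      rw [e1, e2, add_assoc, add_assoc]
      congr 1
      rw [add_comm, e3, add_comm]
  obtain ⟨l', b', a', r', hd, hval⟩ := exists_sortValue_eq (D := D) (base := base)
    ⟨l, b, a, r, (⟨rfl, h⟩ : IsDescent (l ++ b :: a :: r) l b a r)⟩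
  rw [hval]
  have ih' : ∀ l₁ b₁ a₁ r₁, a₁ < b₁ → (l₁ ++ b₁ :: a₁ :: r₁).length = n →
        inversions (l₁ ++ b₁ :: a₁ :: r₁) < inversions (l ++ b :: a :: r) →
        sortValue D base (l₁ ++ b₁ :: a₁ :: r₁) =
          sortValue D base (l₁ ++ a₁ :: b₁ :: r₁) + D l₁ b₁ a₁ r₁ :=
    fun l₁ b₁ a₁ r₁ h1 h2 h3 => ih _ h3 l₁ b₁ a₁ r₁ h1 h2 rfl
  rcases le_total l.length l'.length with hle | hle
  · exact (key l b a r l' b' a' r' h hd.2 hle hn hd.1 ih').symm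
  · exact key l' b' a' r' l b a r hd.2 h hle (hd.1 ▸ hn) hd.1.symm (hd.1 ▸ ih')

end Sorting

/-! ### Words in the crossed products -/

section Words

variable {Γ V : Type*} [Group Γ] [AddCommGroup V] [Module ℝ V] (ρ : Representation ℝ Γ V)

/-- The inclusion `V* → T(V*) ⋊ Γ`. -/
def TensCross.vecHom : Module.Dual ℝ V →ₗ[ℝ] TensCross ρ :=
  SkewMonoidAlgebra.lsingle (R := ℝ) 1 ∘ₗ TensV.ι ρ

/-- The inclusion `Γ → T(V*) ⋊ Γ`. -/
def TensCross.grp (g : Γ) : TensCross ρ := SkewMonoidAlgebra.single g 1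

/-- The inclusion `Γ → S(V*) ⋊ Γ`. -/
def SymCross.grp (g : Γ) : SymCross ρ := SkewMonoidAlgebra.single g 1

open TensCross

theorem TensCross.vecHom_apply (x : Module.Dual ℝ V) :
    vecHom ρ x = SkewMonoidAlgebra.single 1 (TensV.ι ρ x) := rfl

theorem TensCross.vec_one (x : Module.Dual ℝ V) : vec ρ x 1 = vecHom ρ x := rfl

theorem TensCross.smul_ι (g : Γ) (x : Module.Dual ℝ V) :
    g • TensV.ι ρ x = TensV.ι ρ (ρ.dual g x) := TensV.act_ι ρ g x

theorem TensCross.vecHom_mul_grp (x : Module.Dual ℝ V) (g : Γ) :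
    vecHom ρ x * grp ρ g = vec ρ x g := by
  rw [vecHom_apply, grp, SkewMonoidAlgebra.single_mul_single, one_smul, mul_one, one_mul, vec]

theorem TensCross.grp_mul_vecHom (g : Γ) (x : Module.Dual ℝ V) :
    grp ρ g * vecHom ρ x = vecHom ρ (ρ.dual g x) * grp ρ g := by
  rw [vecHom_mul_grp, vecHom_apply, grp, SkewMonoidAlgebra.single_mul_single, mul_one, one_mul,
    vec, smul_ι]

theorem TensCross.grp_mul_grp (g h : Γ) : grp ρ g * grp ρ h = grp ρ (g * h) := by
  rw [grp, grp, SkewMonoidAlgebra.single_mul_single, smul_one, mul_one, grp]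

theorem TensCross.grp_one : grp ρ 1 = 1 := rfl

theorem SymCross.grp_mul_grp (g h : Γ) : grp ρ g * grp ρ h = grp ρ (g * h) := by
  rw [grp, grp, SkewMonoidAlgebra.single_mul_single, smul_one, mul_one, grp]

theorem SymCross.grp_one : grp ρ 1 = 1 := rfl

variable {κ : Type*} (b : Module.Basis κ ℝ (Module.Dual ℝ V))

/-- The product of the letters of a word, in `T(V*)`. -/
def TensV.word (w : List κ) : TensV ρ := (w.map fun i => TensV.ι ρ (b i)).prod

/-- The product of the letters of a word, in `T(V*) ⋊ Γ`. -/
def TensCross.word (w : List κ) : TensCross ρ := (w.map fun i => vecHom ρ (b i)).prod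

theorem TensCross.word_append (w w' : List κ) : word ρ b (w ++ w') = word ρ b w * word ρ b w' := by
  simp [word]

theorem TensCross.word_cons (i : κ) (w : List κ) :
    word ρ b (i :: w) = vecHom ρ (b i) * word ρ b w := by
  simp [word]

theorem TensCross.word_nil : word ρ b [] = 1 := rfl

theorem TensCross.word_eq_single (w : List κ) :
    word ρ b w = SkewMonoidAlgebra.single 1 (TensV.word ρ b w) := by
  induction w with
  | nil => rfl
  | cons i w ih =>
    rw [word_cons, ih, vecHom_apply, SkewMonoidAlgebra.single_mul_single, one_smul, one_mul]
    simp [TensV.word]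

theorem TensCross.word_mul_grp (w : List κ) (g : Γ) :
    word ρ b w * grp ρ g = SkewMonoidAlgebra.single g (TensV.word ρ b w) := by
  rw [word_eq_single, grp, SkewMonoidAlgebra.single_mul_single, one_smul, one_mul, mul_one]

/-- The words form a basis of `T(V*)`. -/
def TensV.basis : Module.Basis (List κ) ℝ (TensV ρ) := b.tensorAlgebra

theorem TensV.basis_apply (w : List κ) : TensV.basis ρ b w = TensV.word ρ b w := by
  have h : ∀ w : FreeMonoid κ, (TensorAlgebra.equivFreeAlgebra b).symm
      (FreeAlgebra.basisFreeMonoid ℝ κ w) =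
        (w.toList.map fun i => TensorAlgebra.ι ℝ (b i)).prod := by
    intro w
    induction w using FreeMonoid.inductionOn' with
    | one => simp [FreeAlgebra.basisFreeMonoid, MonoidAlgebra.one_def]
    | of_mul i w ih =>
      have : FreeAlgebra.basisFreeMonoid ℝ κ (FreeMonoid.of i * w) =
          FreeAlgebra.ι ℝ i * FreeAlgebra.basisFreeMonoid ℝ κ w := by
        have h2 : FreeAlgebra.equivMonoidAlgebraFreeMonoid.symm
            (MonoidAlgebra.single (FreeMonoid.of i) (1 : ℝ)) = FreeAlgebra.ι ℝ i := by
          rw [AlgEquiv.symm_apply_eq]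
          simp [FreeAlgebra.equivMonoidAlgebraFreeMonoid]
        simp only [FreeAlgebra.basisFreeMonoid, Module.Basis.map_apply, Finsupp.coe_basisSingleOne]
        rw [← h2]
        change FreeAlgebra.equivMonoidAlgebraFreeMonoid.symm (MonoidAlgebra.single _ 1) =
          _ * FreeAlgebra.equivMonoidAlgebraFreeMonoid.symm (MonoidAlgebra.single _ 1)
        rw [← map_mul, MonoidAlgebra.single_mul_single, one_mul]
      rw [this, map_mul, ih]
      simp
  exact h w

/-- The products of words and group elements form a basis of `T(V*) ⋊ Γ`. -/
def TensCross.basis : Module.Basis (Σ _ : Γ, List κ) ℝ (TensCross ρ) :=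
  (Finsupp.basis fun _ : Γ => TensV.basis ρ b).map
    (SkewMonoidAlgebra.coeffLinearEquiv (S := ℝ)).symm

theorem TensCross.basis_apply (g : Γ) (w : List κ) :
    TensCross.basis ρ b ⟨g, w⟩ = word ρ b w * grp ρ g := by
  rw [word_mul_grp, TensCross.basis, Module.Basis.map_apply, Finsupp.coe_basis]
  simp only [TensV.basis_apply]
  rfl

theorem TensCross.single_mem_tensDeg {n : ℕ} {t : TensV ρ}
    (ht : t ∈ LinearMap.range (TensV.ι ρ) ^ n) (g : Γ) :
    SkewMonoidAlgebra.single g t ∈ tensDeg ρ n := by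
  classical
  intro h
  rw [SkewMonoidAlgebra.coeff_single_apply]
  split
  · exact ht
  · exact zero_mem _

/-- The group acts by degree-preserving automorphisms, so the twist in the product respects the
grading. -/
theorem TensCross.mul_mem_tensDeg {m n : ℕ} {p q : TensCross ρ} (hp : p ∈ tensDeg ρ m)
    (hq : q ∈ tensDeg ρ n) : p * q ∈ tensDeg ρ (m + n) := by
  have hact : ∀ (g : Γ) (t : TensV ρ), t ∈ LinearMap.range (TensV.ι ρ) ^ n →
      g • t ∈ LinearMap.range (TensV.ι ρ) ^ n := by
    intro g t ht
    have h1 : TensV.act ρ g t ∈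
        ((LinearMap.range (TensV.ι ρ)) ^ n).map (TensV.act ρ g).toLinearMap := ⟨t, ht, rfl⟩
    rw [Submodule.map_pow] at h1
    refine pow_le_pow_left' (?_ : _ ≤ LinearMap.range (TensV.ι ρ)) n h1
    rintro _ ⟨_, ⟨x, rfl⟩, rfl⟩
    exact ⟨ρ.dual g x, (TensV.act_ι ρ g x).symm⟩
  rw [SkewMonoidAlgebra.mul_def]
  refine Submodule.sum_mem _ fun g _ => Submodule.sum_mem _ fun h _ => ?_
  apply single_mem_tensDeg
  rw [pow_add]
  exact Submodule.mul_mem_mul (hp g) (hact g _ (hq h))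

theorem TensCross.grp_mem_tensDeg (g : Γ) : grp ρ g ∈ tensDeg ρ 0 :=
  single_mem_tensDeg ρ (by rw [pow_zero]; exact Submodule.one_le.1 le_rfl) g

theorem TensCross.vecHom_mem_tensDeg (x : Module.Dual ℝ V) : vecHom ρ x ∈ tensDeg ρ 1 :=
  single_mem_tensDeg ρ (by rw [pow_one]; exact ⟨x, rfl⟩) 1

theorem TensCross.word_mem_tensDeg (w : List κ) : word ρ b w ∈ tensDeg ρ w.length := by
  induction w with
  | nil => exact grp_mem_tensDeg ρ 1
  | cons i w ih =>
    rw [word_cons, List.length_cons, add_comm]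
    exact mul_mem_tensDeg ρ (vecHom_mem_tensDeg ρ _) ih

theorem TensV.mem_span_word {n : ℕ} {t : TensV ρ} (ht : t ∈ LinearMap.range (TensV.ι ρ) ^ n) :
    t ∈ Submodule.span ℝ {t | ∃ w : List κ, w.length = n ∧ t = TensV.word ρ b w} := by
  induction n generalizing t with
  | zero =>
    rw [pow_zero, Submodule.mem_one] at ht
    obtain ⟨r, rfl⟩ := ht
    rw [Algebra.algebraMap_eq_smul_one]
    exact Submodule.smul_mem _ _ (Submodule.subset_span ⟨[], rfl, rfl⟩)
  | succ n ih =>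
    rw [pow_succ'] at ht
    induction ht using Submodule.mul_induction_on' with
    | add x _ y _ hx hy => exact add_mem hx hy
    | mem_mul_mem x hx y hy =>
      obtain ⟨x, rfl⟩ := hx
      have hy' := ih hy
      clear hy
      induction b.mem_span x using Submodule.span_induction with
      | mem x hx =>
        obtain ⟨i, rfl⟩ := hx
        induction hy' using Submodule.span_induction with
        | mem y hy =>
          obtain ⟨w, rfl, rfl⟩ := hy
          exact Submodule.subset_span ⟨i :: w, rfl, by simp [word]⟩
        | zero => rw [mul_zero]; exact zero_mem _
        | add y z _ _ hy hz => rw [mul_add]; exact add_mem hy hz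
        | smul r y _ hy => rw [mul_smul_comm]; exact Submodule.smul_mem _ _ hy
      | zero => rw [map_zero, zero_mul]; exact zero_mem _
      | add y z _ _ hy hz => rw [map_add, add_mul]; exact add_mem hy hz
      | smul r y _ hy => rw [map_smul, smul_mul_assoc]; exact Submodule.smul_mem _ _ hy

theorem TensCross.tensDeg_induction {n : ℕ} {P : TensCross ρ → Prop} (h0 : P 0)
    (hadd : ∀ p q, P p → P q → P (p + q)) (hsmul : ∀ (r : ℝ) p, P p → P (r • p))
    (hword : ∀ (w : List κ) (g : Γ), w.length = n → P (word ρ b w * grp ρ g))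
    {p : TensCross ρ} (hp : p ∈ tensDeg ρ n) : P p := by
  have hs : ∀ (g : Γ) (t : TensV ρ), t ∈ LinearMap.range (TensV.ι ρ) ^ n →
      P (SkewMonoidAlgebra.single g t) := by
    intro g t ht
    have ht' := TensV.mem_span_word ρ b ht
    clear ht
    induction ht' using Submodule.span_induction with
    | mem x hx =>
      obtain ⟨w, hw, rfl⟩ := hx
      rw [← word_mul_grp]
      exact hword w g hw
    | zero => rwa [SkewMonoidAlgebra.single_zero]
    | add x y _ _ hx hy => rw [SkewMonoidAlgebra.single_add]; exact hadd _ _ hx hy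
    | smul r x _ hx => rw [← SkewMonoidAlgebra.smul_single]; exact hsmul _ _ hx
  rw [← SkewMonoidAlgebra.sum_single p, SkewMonoidAlgebra.sum_def']
  exact Finset.sum_induction _ P (fun p q => hadd p q) h0 fun g _ => hs g _ (hp g)

end Words

/-! ### Monomials and polynomial degree in S(V*) ⋊ Γ -/

section SymWords

variable {Γ V : Type*} [Group Γ] [AddCommGroup V] [Module ℝ V] (ρ : Representation ℝ Γ V)

open TensCross

/-- The canonical surjection `T(V*) ⋊ Γ → S(V*) ⋊ Γ` as a linear map. -/
def TensCross.toSymCrossₗ : TensCross ρ →ₗ[ℝ] SymCross ρ where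
  toFun := toSymCross ρ
  map_add' p q := by
    ext g
    simp [toSymCross]
  map_smul' r p := by
    ext g
    simp [toSymCross]

theorem TensCross.toSymCrossₗ_apply (p : TensCross ρ) : toSymCrossₗ ρ p = toSymCross ρ p := rfl

theorem TensCross.toSymCrossₗ_single (g : Γ) (t : TensV ρ) :
    toSymCrossₗ ρ (SkewMonoidAlgebra.single g t) =
      SkewMonoidAlgebra.single g (TensV.toSym ρ t) := by
  change (⟨_⟩ : SymCross ρ) = ⟨_⟩
  rw [SkewMonoidAlgebra.coeff_single, Finsupp.mapRange_single]

theorem SymCross.single_mul_grp (g h : Γ) (s : SymV ρ) :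
    SkewMonoidAlgebra.single g s * SymCross.grp ρ h = SkewMonoidAlgebra.single (g * h) s := by
  rw [SymCross.grp, SkewMonoidAlgebra.single_mul_single, smul_one, mul_one]

variable {κ : Type*} [DecidableEq κ] (b : Module.Basis κ ℝ (Module.Dual ℝ V))

/-- The commutative monomials form a basis of `S(V*)`. -/
def SymV.basis : Module.Basis (Multiset κ) ℝ (SymV ρ) :=
  (b.symmetricAlgebra).reindex Multiset.toFinsupp.symm.toEquiv

theorem SymV.basis_coe (w : List κ) : SymV.basis ρ b w = TensV.toSym ρ (TensV.word ρ b w) := by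
  have h1 : ∀ m, b.symmetricAlgebra m =
      (SymmetricAlgebra.equivMvPolynomial b).symm (MvPolynomial.monomial m 1) := fun m => by
    simp [Module.Basis.symmetricAlgebra]
  have h2 : (SymmetricAlgebra.equivMvPolynomial b).symm
      (MvPolynomial.monomial (Multiset.toFinsupp (w : Multiset κ)) 1) =
        (w.map fun i => SymmetricAlgebra.ι ℝ (Module.Dual ℝ V) (b i)).prod := by
    induction w with
    | nil => simp
    | cons i w ih =>
      have h : MvPolynomial.monomial (Multiset.toFinsupp ((i :: w : List κ) : Multiset κ)) (1 : ℝ) =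
          MvPolynomial.X i * MvPolynomial.monomial (Multiset.toFinsupp (w : Multiset κ)) 1 := by
        rw [← Multiset.cons_coe, ← Multiset.singleton_add, map_add, Multiset.toFinsupp_singleton,
          MvPolynomial.X, MvPolynomial.monomial_mul, one_mul]
      rw [h, map_mul, ih, SymmetricAlgebra.equivMvPolynomial_symm_X, List.map_cons,
        List.prod_cons]
  have h3 : TensV.toSym ρ (TensV.word ρ b w) = (w.map fun i => SymV.ι ρ (b i)).prod := by
    rw [TensV.word, map_list_prod, List.map_map]
    congr 2
  rw [h3]
  exact ((Module.Basis.reindex_apply _ _ _).trans (h1 _)).trans h2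

/-- The products of commutative monomials and group elements form a basis of `S(V*) ⋊ Γ`. -/
def SymCross.basis : Module.Basis (Σ _ : Γ, Multiset κ) ℝ (SymCross ρ) :=
  (Finsupp.basis fun _ : Γ => SymV.basis ρ b).map
    (SkewMonoidAlgebra.coeffLinearEquiv (S := ℝ)).symm

theorem SymCross.basis_apply (g : Γ) (m : Multiset κ) :
    SymCross.basis ρ b ⟨g, m⟩ = SkewMonoidAlgebra.single g (SymV.basis ρ b m) := by
  rw [SymCross.basis, Module.Basis.map_apply, Finsupp.coe_basis]
  rfl

/-- Since the left side sees only the multiset of letters, this also records that reordering a word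
does not change its symbol. -/
theorem SymCross.basis_coe (g : Γ) (w : List κ) :
    SymCross.basis ρ b ⟨g, w⟩ = toSymCross ρ (word ρ b w * TensCross.grp ρ g) := by
  rw [basis_apply, word_mul_grp, ← toSymCrossₗ_apply, toSymCrossₗ_single, SymV.basis_coe]

/-- The projection of `S(V*) ⋊ Γ` to its component of polynomial degree `k`. -/
def SymCross.proj (k : ℤ) : SymCross ρ →ₗ[ℝ] SymCross ρ :=
  (SymCross.basis ρ b).constr ℝ fun i =>
    if (i.2.card : ℤ) = k then SymCross.basis ρ b i else 0

theorem SymCross.proj_basis (k : ℤ) (i : Σ _ : Γ, Multiset κ) :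
    SymCross.proj ρ b k (SymCross.basis ρ b i) =
      if (i.2.card : ℤ) = k then SymCross.basis ρ b i else 0 :=
  Module.Basis.constr_basis _ _ _ _

theorem SymCross.proj_toSymCross (k : ℤ) {n : ℕ} {p : TensCross ρ} (hp : p ∈ tensDeg ρ n) :
    SymCross.proj ρ b k (toSymCross ρ p) = if (n : ℤ) = k then toSymCross ρ p else 0 := by
  simp only [← toSymCrossₗ_apply]
  refine tensDeg_induction ρ b (P := fun p => SymCross.proj ρ b k (toSymCrossₗ ρ p) =
    if (n : ℤ) = k then toSymCrossₗ ρ p else 0) ?_ ?_ ?_ ?_ hp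
  · simp
  · intro p q hp hq
    rw [map_add, map_add, hp, hq]
    split <;> simp
  · intro r p hp
    rw [map_smul, map_smul, hp]
    split <;> simp
  · intro w g hw
    rw [toSymCrossₗ_apply, ← basis_coe, proj_basis]
    simp [hw]

/-- The part of `S(V*) ⋊ Γ` of polynomial degree less than `n`. -/
def SymCross.degLT (n : ℕ) : Submodule ℝ (SymCross ρ) :=
  Submodule.span ℝ {a | ∃ g, ∃ m : Multiset κ, m.card < n ∧ a = SymCross.basis ρ b ⟨g, m⟩}

theorem SymCross.degLT_mono {m n : ℕ} (h : m ≤ n) :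
    SymCross.degLT ρ b m ≤ SymCross.degLT ρ b n := by
  apply Submodule.span_mono
  rintro _ ⟨g, m, hm, rfl⟩
  exact ⟨g, m, hm.trans_le h, rfl⟩

theorem SymCross.proj_of_mem_degLT {k : ℤ} {n : ℕ} (h : (n : ℤ) ≤ k) {a : SymCross ρ}
    (ha : a ∈ SymCross.degLT ρ b n) : SymCross.proj ρ b k a = 0 := by
  induction ha using Submodule.span_induction with
  | mem a ha =>
    obtain ⟨g, m, hm, rfl⟩ := ha
    rw [proj_basis, if_neg]
    dsimp only
    omega
  | zero => simp
  | add x y _ _ hx hy => simp [hx, hy]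
  | smul r x _ hx => simp [hx]

theorem SymCross.mul_grp_mem_degLT {n : ℕ} {a : SymCross ρ} (ha : a ∈ SymCross.degLT ρ b n)
    (h : Γ) : a * SymCross.grp ρ h ∈ SymCross.degLT ρ b n := by
  induction ha using Submodule.span_induction with
  | mem a ha =>
    obtain ⟨g, m, hm, rfl⟩ := ha
    rw [basis_apply, single_mul_grp, ← basis_apply]
    exact Submodule.subset_span ⟨g * h, m, hm, rfl⟩
  | zero => simp
  | add x y _ _ hx hy => rw [add_mul]; exact add_mem hx hy
  | smul r x _ hx => rw [smul_mul_assoc]; exact Submodule.smul_mem _ _ hx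

theorem SymCross.toSymCross_mem_degLT {m n : ℕ} (h : m < n) {p : TensCross ρ}
    (hp : p ∈ tensDeg ρ m) : toSymCross ρ p ∈ SymCross.degLT ρ b n := by
  simp only [← toSymCrossₗ_apply]
  refine tensDeg_induction ρ b (P := fun p => toSymCrossₗ ρ p ∈ SymCross.degLT ρ b n)
    ?_ ?_ ?_ ?_ hp
  · rw [map_zero]
    exact zero_mem _
  · intro p q hp hq
    rw [map_add]
    exact add_mem hp hq
  · intro r p hp
    rw [map_smul]
    exact Submodule.smul_mem _ _ hp
  · intro w g hw
    rw [toSymCrossₗ_apply, ← basis_coe]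
    exact Submodule.subset_span ⟨g, w, by simpa [hw] using h, rfl⟩

theorem SymCross.eq_zero_of_toSymCross_mem_degLT {n : ℕ} {p : TensCross ρ}
    (hp : p ∈ tensDeg ρ n) (h : toSymCross ρ p ∈ SymCross.degLT ρ b n) :
    toSymCross ρ p = 0 := by
  have h1 := proj_of_mem_degLT ρ b le_rfl h
  rwa [proj_toSymCross ρ b _ hp, if_pos rfl] at h1

end SymWords

/-! ### The commutation relations -/

section Relations

variable {Γ V : Type*} [CommGroup Γ] [Fintype Γ] [AddCommGroup V] [Module ℝ V]
  {ρ : Representation ℝ Γ V} {π : LinearCochain Γ V}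

open TensCross

/-- The element `∑_γ π_γ(x,y)γ` of `T(V*) ⋊ Γ`. -/
def TensCross.bracket (ρ : Representation ℝ Γ V) (π : LinearCochain Γ V) :
    Module.Dual ℝ V →ₗ[ℝ] Module.Dual ℝ V →ₗ[ℝ] TensCross ρ :=
  ∑ γ : Γ, (π γ).compr₂ (LinearMap.mulRight ℝ (grp ρ γ) ∘ₗ vecHom ρ)

theorem TensCross.bracket_apply (x y : Module.Dual ℝ V) :
    bracket ρ π x y = ∑ γ : Γ, vecHom ρ (π γ x y) * grp ρ γ := by
  simp [bracket, LinearMap.sum_apply]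

/-- The relator `x ⊗ y - y ⊗ x - ∑_γ π_γ(x,y)γ`. -/
def TensCross.relator (ρ : Representation ℝ Γ V) (π : LinearCochain Γ V) :
    Module.Dual ℝ V →ₗ[ℝ] Module.Dual ℝ V →ₗ[ℝ] TensCross ρ :=
  (LinearMap.mul ℝ (TensCross ρ)).compl₁₂ (vecHom ρ) (vecHom ρ) -
    ((LinearMap.mul ℝ (TensCross ρ)).compl₁₂ (vecHom ρ) (vecHom ρ)).flip - bracket ρ π

theorem TensCross.relator_apply (x y : Module.Dual ℝ V) :
    relator ρ π x y = vecHom ρ x * vecHom ρ y - vecHom ρ y * vecHom ρ x - bracket ρ π x y := by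
  simp [relator]

theorem TensCross.bracket_mem_tensDeg (x y : Module.Dual ℝ V) :
    bracket ρ π x y ∈ tensDeg ρ 1 := by
  rw [bracket_apply]
  exact Submodule.sum_mem _ fun γ _ =>
    mul_mem_tensDeg ρ (vecHom_mem_tensDeg ρ _) (grp_mem_tensDeg ρ γ)

theorem IsLinearCocycle.relator_self (hπ : IsLinearCocycle ρ π) (x : Module.Dual ℝ V) :
    relator ρ π x x = 0 := by
  simp [relator_apply, bracket_apply, hπ.alternating]

/-- Invariance of π lets group elements be moved past a relator. -/
theorem IsLinearCocycle.grp_mul_relator (hπ : IsLinearCocycle ρ π) (g : Γ)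
    (x y : Module.Dual ℝ V) :
    grp ρ g * relator ρ π x y = relator ρ π (ρ.dual g x) (ρ.dual g y) * grp ρ g := by
  have h : ∀ x y, grp ρ g * (vecHom ρ x * vecHom ρ y) =
      vecHom ρ (ρ.dual g x) * vecHom ρ (ρ.dual g y) * grp ρ g := fun x y => by
    rw [← mul_assoc, grp_mul_vecHom, mul_assoc, grp_mul_vecHom, mul_assoc]
  rw [relator_apply, relator_apply, mul_sub, mul_sub, sub_mul, sub_mul, h, h, bracket_apply,
    bracket_apply, Finset.mul_sum, Finset.sum_mul]
  congr 1
  refine Finset.sum_congr rfl fun γ _ => ?_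
  rw [← mul_assoc, grp_mul_vecHom, hπ.dual_apply, mul_assoc, mul_assoc, grp_mul_grp, grp_mul_grp,
    mul_comm g]

/-- One of the three terms of the overlap of the relations. -/
theorem TensCross.two_smul_bracket_mul_sub (x y z : Module.Dual ℝ V) :
    (2 : ℝ) • (bracket ρ π x y * vecHom ρ z - vecHom ρ z * bracket ρ π x y) =
      ∑ γ : Γ, relator ρ π (π γ x y) (z + ρ.dual γ z) * grp ρ γ +
      ∑ γ : Γ, bracket ρ π (π γ x y) (z + ρ.dual γ z) * grp ρ γ -
      ∑ γ : Γ, (vecHom ρ (π γ x y) * vecHom ρ (z - ρ.dual γ z) +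
        vecHom ρ (z - ρ.dual γ z) * vecHom ρ (π γ x y)) * grp ρ γ := by
  rw [bracket_apply, Finset.sum_mul, Finset.mul_sum, ← Finset.sum_sub_distrib, Finset.smul_sum,
    ← Finset.sum_add_distrib, ← Finset.sum_sub_distrib]
  refine Finset.sum_congr rfl fun γ _ => ?_
  -- With a = π_γ(x,y) and γz = ᵞz γ, the identity is 2(a ᵞz - z a) = [a, z + ᵞz] - (a(z - ᵞz) + (z
  -- - ᵞz)a), where the commutator is relator plus bracket. This is the origin of z + ᵞz in ⟦π,π⟧.
  rw [← add_mul, ← sub_mul, relator_apply, sub_add_cancel, mul_assoc, grp_mul_vecHom, ← mul_assoc,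
    ← mul_assoc, ← sub_mul, ← smul_mul_assoc, two_smul, map_add, map_sub]
  congr 1
  noncomm_ring

/-- Iterated brackets, collected by the product δ of their two group elements, are the components of
⟦π,π⟧. -/
theorem TensCross.sum_bracket_mul_grp (x : Fin 3 → Module.Dual ℝ V) :
    ∑ γ : Γ, bracket ρ π (π γ (x 0) (x 1)) (x 2 + ρ.dual γ (x 2)) * grp ρ γ +
      ∑ γ : Γ, bracket ρ π (π γ (x 1) (x 2)) (x 0 + ρ.dual γ (x 0)) * grp ρ γ +
      ∑ γ : Γ, bracket ρ π (π γ (x 2) (x 0)) (x 1 + ρ.dual γ (x 1)) * grp ρ γ =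
    ∑ δ : Γ, vecHom ρ (doubleBracket ρ π δ x) * grp ρ δ := by
  have h : ∀ x y z, ∑ γ : Γ, bracket ρ π (π γ x y) (z + ρ.dual γ z) * grp ρ γ =
      ∑ δ : Γ, ∑ γ : Γ, vecHom ρ (π (δ * γ⁻¹) (π γ x y) (z + ρ.dual γ z)) * grp ρ δ := by
    intro x y z
    rw [Finset.sum_comm]
    refine Finset.sum_congr rfl fun γ _ => ?_
    rw [bracket_apply, Finset.sum_mul, ← Equiv.sum_comp (Equiv.mulRight γ⁻¹)]
    refine Finset.sum_congr rfl fun δ _ => ?_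
    rw [mul_assoc, grp_mul_grp, Equiv.coe_mulRight, inv_mul_cancel_right]
  rw [h, h, h, ← Finset.sum_add_distrib, ← Finset.sum_add_distrib]
  refine Finset.sum_congr rfl fun δ _ => ?_
  rw [doubleBracket, map_sum, Finset.sum_mul, ← Finset.sum_add_distrib, ← Finset.sum_add_distrib]
  refine Finset.sum_congr rfl fun γ _ => ?_
  rw [map_add (vecHom ρ), map_add (vecHom ρ), add_mul, add_mul]

/-- Jacobi holds modulo relators: the brackets of brackets sum to ⟦π,π⟧ = 0, the symmetrized
products vanish by the cocycle condition, and only relators of the same degree remain. -/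
theorem IsLinearPoisson.two_smul_jacobi [FiniteDimensional ℝ V] (hρ : Function.Injective ρ)
    (hπ : IsLinearPoisson ρ π) (x y z : Module.Dual ℝ V) :
    (2 : ℝ) • ((bracket ρ π x y * vecHom ρ z - vecHom ρ z * bracket ρ π x y) +
      (bracket ρ π y z * vecHom ρ x - vecHom ρ x * bracket ρ π y z) +
      (bracket ρ π z x * vecHom ρ y - vecHom ρ y * bracket ρ π z x)) =
      ∑ γ : Γ, (relator ρ π (π γ x y) (z + ρ.dual γ z) +
        relator ρ π (π γ y z) (x + ρ.dual γ x) +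
        relator ρ π (π γ z x) (y + ρ.dual γ y)) * grp ρ γ := by
  have h1 := sum_bracket_mul_grp (ρ := ρ) (π := π) ![x, y, z]
  simp only [hπ.doubleBracket_eq_zero hρ, map_zero, zero_mul, Finset.sum_const_zero,
    Matrix.cons_val_zero, Matrix.cons_val_one, Matrix.cons_val] at h1
  have h2 : ∑ γ : Γ, (vecHom ρ (π γ x y) * vecHom ρ (z - ρ.dual γ z) +
        vecHom ρ (z - ρ.dual γ z) * vecHom ρ (π γ x y)) * grp ρ γ +
      ∑ γ : Γ, (vecHom ρ (π γ y z) * vecHom ρ (x - ρ.dual γ x) +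
        vecHom ρ (x - ρ.dual γ x) * vecHom ρ (π γ y z)) * grp ρ γ +
      ∑ γ : Γ, (vecHom ρ (π γ z x) * vecHom ρ (y - ρ.dual γ y) +
        vecHom ρ (y - ρ.dual γ y) * vecHom ρ (π γ z x)) * grp ρ γ = 0 := by
    rw [← Finset.sum_add_distrib, ← Finset.sum_add_distrib]
    refine Finset.sum_eq_zero fun γ _ => ?_
    have h := hπ.toIsLinearCocycle.cyclic_sum_eq_zero hρ
      ((LinearMap.mul ℝ (TensCross ρ)).compl₁₂ (vecHom ρ) (vecHom ρ) +
        ((LinearMap.mul ℝ (TensCross ρ)).compl₁₂ (vecHom ρ) (vecHom ρ)).flip) γ x y z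
    simp only [LinearMap.add_apply, LinearMap.flip_apply, LinearMap.compl₁₂_apply,
      LinearMap.mul_apply'] at h
    rw [← add_mul, ← add_mul, h, zero_mul]
  have habel : ∀ R₁ R₂ R₃ B₁ B₂ B₃ Q₁ Q₂ Q₃ : TensCross ρ, B₁ + B₂ + B₃ = 0 →
      Q₁ + Q₂ + Q₃ = 0 → R₁ + B₁ - Q₁ + (R₂ + B₂ - Q₂) + (R₃ + B₃ - Q₃) = R₁ + R₂ + R₃ := by
    intro R₁ R₂ R₃ B₁ B₂ B₃ Q₁ Q₂ Q₃ hB hQ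
    rw [← sub_eq_zero, ← sub_zero (0 : TensCross ρ)]
    nth_rewrite 1 [← hB]
    rw [← hQ]
    abel
  rw [smul_add, smul_add, two_smul_bracket_mul_sub, two_smul_bracket_mul_sub,
    two_smul_bracket_mul_sub, habel _ _ _ _ _ _ _ _ _ h1 h2, ← Finset.sum_add_distrib,
    ← Finset.sum_add_distrib]
  simp only [add_mul]

end Relations

/-! ### Normal ordering -/

section NormalOrder

variable {Γ V : Type*} [CommGroup Γ] [AddCommGroup V] [Module ℝ V]
  (ρ : Representation ℝ Γ V) (π : LinearCochain Γ V) {κ : Type*}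
  (b : Module.Basis κ ℝ (Module.Dual ℝ V))

open TensCross

/-- The right `Γ`-linear map on `T(V*) ⋊ Γ` with prescribed values on words. -/
def wordExtend (f : List κ → SymCross ρ) : TensCross ρ →ₗ[ℝ] SymCross ρ :=
  (TensCross.basis ρ b).constr ℝ fun i => f i.2 * SymCross.grp ρ i.1

theorem wordExtend_word_mul_grp (f : List κ → SymCross ρ) (w : List κ) (g : Γ) :
    wordExtend ρ b f (word ρ b w * grp ρ g) = f w * SymCross.grp ρ g := by
  rw [← TensCross.basis_apply, wordExtend, Module.Basis.constr_basis]

theorem wordExtend_word (f : List κ → SymCross ρ) (w : List κ) :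
    wordExtend ρ b f (word ρ b w) = f w := by
  have h := wordExtend_word_mul_grp ρ b f w 1
  rwa [grp_one, mul_one, SymCross.grp_one, mul_one] at h

theorem wordExtend_mul_grp (f : List κ → SymCross ρ) (p : TensCross ρ) (h : Γ) :
    wordExtend ρ b f (p * grp ρ h) = wordExtend ρ b f p * SymCross.grp ρ h := by
  have key : wordExtend ρ b f ∘ₗ LinearMap.mulRight ℝ (grp ρ h) =
      LinearMap.mulRight ℝ (SymCross.grp ρ h) ∘ₗ wordExtend ρ b f := by
    refine (TensCross.basis ρ b).ext fun ⟨g, w⟩ => ?_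
    simp only [LinearMap.comp_apply, LinearMap.mulRight_apply, TensCross.basis_apply]
    rw [mul_assoc, grp_mul_grp, wordExtend_word_mul_grp, wordExtend_word_mul_grp, mul_assoc,
      SymCross.grp_mul_grp]
  exact LinearMap.congr_fun key p

variable [Fintype Γ]

/-- The cost of sorting a descent, computed by means of the values on shorter words. -/
def sortCost (f : List κ → SymCross ρ) (l : List κ) (j i : κ) (r : List κ) : SymCross ρ :=
  wordExtend ρ b f (word ρ b l * bracket ρ π (b j) (b i) * word ρ b r)

theorem word_mul_bracket_mul_word_mem_tensDeg (l r : List κ) (x y : Module.Dual ℝ V) :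
    word ρ b l * bracket ρ π x y * word ρ b r ∈ tensDeg ρ (l.length + 1 + r.length) :=
  mul_mem_tensDeg ρ (mul_mem_tensDeg ρ (word_mem_tensDeg ρ b l) (bracket_mem_tensDeg x y))
    (word_mem_tensDeg ρ b r)

variable [LinearOrder κ]

/-- The normally ordered form of the words of length `n`. -/
def orderedValue : ℕ → List κ → SymCross ρ
  | 0 => fun w => toSymCross ρ (word ρ b w)
  | n + 1 => sortValue (sortCost ρ π b (orderedValue n)) fun w => toSymCross ρ (word ρ b w)

/-- The normal ordering map `T(V*) ⋊ Γ → S(V*) ⋊ Γ`. -/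
def normalOrder : TensCross ρ →ₗ[ℝ] SymCross ρ :=
  wordExtend ρ b fun w => orderedValue ρ π b w.length w

theorem wordExtend_orderedValue {n : ℕ} {p : TensCross ρ} (hp : p ∈ tensDeg ρ n) :
    wordExtend ρ b (orderedValue ρ π b n) p = normalOrder ρ π b p := by
  refine tensDeg_induction ρ b
    (P := fun p => wordExtend ρ b (orderedValue ρ π b n) p = normalOrder ρ π b p)
    ?_ ?_ ?_ ?_ hp
  · simp
  · intro p q hp hq
    rw [map_add, map_add, hp, hq]
  · intro r p hp
    rw [map_smul, map_smul, hp]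
  · intro w g hw
    rw [normalOrder, wordExtend_word_mul_grp, wordExtend_word_mul_grp, hw]

theorem normalOrder_mul_grp (p : TensCross ρ) (h : Γ) :
    normalOrder ρ π b (p * grp ρ h) = normalOrder ρ π b p * SymCross.grp ρ h :=
  wordExtend_mul_grp ρ b _ p h

/-- The bracket replaces two letters by exactly one, with no constant term, so the cost in length n
+ 1 involves only length n. This is why a recursion on the length alone suffices. -/
theorem sortCost_orderedValue {n : ℕ} (l : List κ) (j i : κ) (r : List κ)
    (h : (l ++ j :: i :: r).length = n + 1) :
    sortCost ρ π b (orderedValue ρ π b n) l j i r =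
      normalOrder ρ π b (word ρ b l * bracket ρ π (b j) (b i) * word ρ b r) := by
  rw [sortCost]
  apply wordExtend_orderedValue
  have h1 := word_mul_bracket_mul_word_mem_tensDeg ρ π b l r (b j) (b i)
  have h2 : l.length + 1 + r.length = n := by
    simp at h
    omega
  rwa [h2] at h1

variable {ρ π}

/-- Group elements on the right come out by right Γ-linearity; those on the left are first carried
across the relator, which stays a relator. -/
theorem IsLinearCocycle.normalOrder_relator_of_word (hπ : IsLinearCocycle ρ π) {n : ℕ}
    (h : ∀ l r : List κ, l.length + r.length + 2 = n → ∀ x y,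
      normalOrder ρ π b (word ρ b l * relator ρ π x y * word ρ b r) = 0)
    {i j : ℕ} {p q : TensCross ρ} (hp : p ∈ tensDeg ρ i) (hq : q ∈ tensDeg ρ j)
    (hij : i + j + 2 = n) (x y : Module.Dual ℝ V) :
    normalOrder ρ π b (p * relator ρ π x y * q) = 0 := by
  have h1 : ∀ l : List κ, l.length = i → ∀ q ∈ tensDeg ρ j, ∀ x y,
      normalOrder ρ π b (word ρ b l * relator ρ π x y * q) = 0 := by
    intro l hl q hq x y
    refine tensDeg_induction ρ b
      (P := fun q => normalOrder ρ π b (word ρ b l * relator ρ π x y * q) = 0) ?_ ?_ ?_ ?_ hq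
    · simp
    · intro p q hp hq
      rw [mul_add, map_add, hp, hq, add_zero]
    · intro r p hp
      rw [mul_smul_comm, map_smul, hp, smul_zero]
    · intro w g hw
      rw [← mul_assoc, normalOrder_mul_grp, h l w (by omega), zero_mul]
  refine tensDeg_induction ρ b
    (P := fun p => normalOrder ρ π b (p * relator ρ π x y * q) = 0) ?_ ?_ ?_ ?_ hp
  · simp
  · intro p q hp hq
    rw [add_mul, add_mul, map_add, hp, hq, add_zero]
  · intro r p hp
    rw [smul_mul_assoc, smul_mul_assoc, map_smul, hp, smul_zero]
  · intro w g hw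
    rw [mul_assoc (word ρ b w), hπ.grp_mul_relator, ← mul_assoc, mul_assoc]
    refine h1 w hw _ ?_ _ _
    rw [← zero_add j]
    exact mul_mem_tensDeg ρ (grp_mem_tensDeg ρ g) hq

variable [FiniteDimensional ℝ V]

/-- Induction on the total degree `n`. The confluence conditions for words of length `n` are
statements about relators in degree `n - 1`, hence known; `sortValue_swap` then gives degree `n`. -/
theorem IsLinearPoisson.normalOrder_word_relator (hρ : Function.Injective ρ)
    (hπ : IsLinearPoisson ρ π) (n : ℕ) : ∀ l r : List κ, l.length + r.length + 2 = n → ∀ x y,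
      normalOrder ρ π b (word ρ b l * relator ρ π x y * word ρ b r) = 0 := by
  induction n using Nat.strong_induction_on with
  | _ n ih =>
  have hc := hπ.toIsLinearCocycle
  have ih' : ∀ {i j : ℕ} {p q : TensCross ρ}, p ∈ tensDeg ρ i → q ∈ tensDeg ρ j →
      i + j + 2 < n → ∀ x y, normalOrder ρ π b (p * relator ρ π x y * q) = 0 :=
    fun hp hq hij x y =>
      hc.normalOrder_relator_of_word b (ih _ hij) hp hq rfl x y
  obtain _ | k := n
  · intro l r h
    omega
  have hdisj : ∀ (l : List κ) (j i : κ) (m : List κ) (d c : κ) (r : List κ), i < j → c < d →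
      (l ++ j :: i :: (m ++ d :: c :: r)).length = k + 1 →
      sortCost ρ π b (orderedValue ρ π b k) l j i (m ++ d :: c :: r) +
          sortCost ρ π b (orderedValue ρ π b k) (l ++ i :: j :: m) d c r =
        sortCost ρ π b (orderedValue ρ π b k) (l ++ j :: i :: m) d c r +
          sortCost ρ π b (orderedValue ρ π b k) l j i (m ++ c :: d :: r) := by
    intro l j i m d c r _ _ hlen
    simp only [List.length_append, List.length_cons] at hlen
    rw [sortCost_orderedValue, sortCost_orderedValue, sortCost_orderedValue,
      sortCost_orderedValue]
    rotate_left
    iterate 4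
      simp only [List.length_append, List.length_cons]
      omega
    -- The discrepancy between the two orders of swapping is bracket·relator minus relator·bracket,
    -- the product of the two brackets cancelling.
    have h1 := ih' (word_mul_bracket_mul_word_mem_tensDeg ρ π b l m (b j) (b i))
      (word_mem_tensDeg ρ b r) (by omega) (b d) (b c)
    have h2 := ih' (word_mem_tensDeg ρ b l)
      (word_mul_bracket_mul_word_mem_tensDeg ρ π b m r (b d) (b c)) (by omega) (b j) (b i)
    simp only [relator_apply] at h1 h2
    rw [← sub_eq_zero, ← sub_zero (0 : SymCross ρ)]
    nth_rewrite 1 [← h1]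
    rw [← h2]
    simp only [← map_sub, ← map_add]
    congr 1
    simp only [word_append, word_cons]
    noncomm_ring
  have hbraid : ∀ (l : List κ) (c j i : κ) (r : List κ), i < j → j < c →
      (l ++ c :: j :: i :: r).length = k + 1 →
      sortCost ρ π b (orderedValue ρ π b k) l c j (i :: r) +
          sortCost ρ π b (orderedValue ρ π b k) (l ++ [j]) c i r +
          sortCost ρ π b (orderedValue ρ π b k) l j i (c :: r) =
        sortCost ρ π b (orderedValue ρ π b k) (l ++ [c]) j i r +
          sortCost ρ π b (orderedValue ρ π b k) l c i (j :: r) +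
          sortCost ρ π b (orderedValue ρ π b k) (l ++ [i]) c j r := by
    intro l c j i r _ _ hlen
    simp only [List.length_append, List.length_cons] at hlen
    rw [sortCost_orderedValue, sortCost_orderedValue, sortCost_orderedValue,
      sortCost_orderedValue, sortCost_orderedValue, sortCost_orderedValue]
    rotate_left
    iterate 6
      simp only [List.length_append, List.length_cons, List.length_nil]
      omega
    have h2 : ∀ (γ : Γ) (x y : Module.Dual ℝ V),
        normalOrder ρ π b (word ρ b l * relator ρ π x y * (grp ρ γ * word ρ b r)) = 0 :=
      fun γ x y => ih' (word_mem_tensDeg ρ b l)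
        (mul_mem_tensDeg ρ (grp_mem_tensDeg ρ γ) (word_mem_tensDeg ρ b r)) (by omega) x y
    have h3 : bracket ρ π (b i) (b c) = -bracket ρ π (b c) (b i) := by
      simp only [bracket_apply, hc.neg _ (b i) (b c), map_neg, neg_mul, Finset.sum_neg_distrib]
    -- The hexagon discrepancy is the Jacobi sum between `l` and `r`; twice it is a sum of relators
    -- in lower degree, and 2 is invertible.
    have h1 := hπ.two_smul_jacobi hρ (b c) (b j) (b i)
    rw [h3] at h1
    have h4 : (2 : ℝ) • normalOrder ρ π b (word ρ b l *
        ((bracket ρ π (b c) (b j) * vecHom ρ (b i) - vecHom ρ (b i) * bracket ρ π (b c) (b j)) +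
        (bracket ρ π (b j) (b i) * vecHom ρ (b c) - vecHom ρ (b c) * bracket ρ π (b j) (b i)) +
        (-bracket ρ π (b c) (b i) * vecHom ρ (b j) - vecHom ρ (b j) * -bracket ρ π (b c) (b i))) *
        word ρ b r) = 0 := by
      rw [← map_smul, ← smul_mul_assoc, ← mul_smul_comm, h1, Finset.mul_sum, Finset.sum_mul,
        map_sum]
      refine Finset.sum_eq_zero fun γ _ => ?_
      rw [← mul_assoc, mul_assoc, mul_add, mul_add, add_mul, add_mul, map_add, map_add, h2, h2,
        h2, add_zero, add_zero]
    rw [← sub_eq_zero, ← (smul_eq_zero_iff_right (two_ne_zero (α := ℝ))).1 h4]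
    simp only [← map_sub, ← map_add]
    congr 1
    simp only [word_append, word_cons, word_nil]
    noncomm_ring
  have hlt : ∀ (l : List κ) (j i : κ) (r : List κ), i < j → l.length + r.length + 2 = k + 1 →
      normalOrder ρ π b (word ρ b l * relator ρ π (b j) (b i) * word ρ b r) = 0 := by
    intro l j i r hij hlen
    have hlen' : (l ++ j :: i :: r).length = k + 1 := by
      simp only [List.length_append, List.length_cons]
      omega
    have h := sortValue_swap (base := fun w => toSymCross ρ (word ρ b w)) hdisj hbraid l j i r
      hij hlen'
    rw [sortCost_orderedValue ρ π b l j i r hlen'] at h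
    have hw : ∀ w : List κ, w.length = k + 1 →
        sortValue (sortCost ρ π b (orderedValue ρ π b k)) (fun w => toSymCross ρ (word ρ b w)) w =
          normalOrder ρ π b (word ρ b w) := by
      intro w hw
      rw [normalOrder, wordExtend_word, hw]
      rfl
    rw [hw _ hlen', hw (l ++ i :: j :: r) (by simpa using hlen'), ← sub_eq_zero] at h
    rw [← h]
    simp only [← map_sub, ← map_add, relator_apply]
    congr 1
    simp only [word_append, word_cons]
    noncomm_ring
  intro l r hlen x y
  have key : (relator ρ π).compr₂ (normalOrder ρ π b ∘ₗ LinearMap.mulLeft ℝ (word ρ b l) ∘ₗ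
      LinearMap.mulRight ℝ (word ρ b r)) = 0 := by
    -- The relator is bilinear and alternating, so the pairs i < j of basis vectors determine it.
    refine b.ext fun j => b.ext fun i => ?_
    simp only [LinearMap.compr₂_apply, LinearMap.comp_apply, LinearMap.mulLeft_apply,
      LinearMap.mulRight_apply, LinearMap.zero_apply, ← mul_assoc]
    rcases lt_trichotomy i j with hij | rfl | hij
    · exact hlt l j i r hij hlen
    · rw [hc.relator_self, mul_zero, zero_mul, map_zero]
    · rw [neg_of_alternating hc.relator_self, mul_neg, neg_mul, map_neg, hlt l i j r hij hlen,
        neg_zero]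
  have h := LinearMap.congr_fun (LinearMap.congr_fun key x) y
  simpa only [LinearMap.compr₂_apply, LinearMap.comp_apply, LinearMap.mulLeft_apply,
      LinearMap.mulRight_apply, LinearMap.zero_apply, ← mul_assoc] using h

theorem IsLinearPoisson.normalOrder_relator (hρ : Function.Injective ρ)
    (hπ : IsLinearPoisson ρ π) (p q : TensCross ρ) (x y : Module.Dual ℝ V) :
    normalOrder ρ π b (p * relator ρ π x y * q) = 0 := by
  have h : ∀ i j, normalOrder ρ π b (TensCross.basis ρ b i * relator ρ π x y *
      TensCross.basis ρ b j) = 0 := by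
    rintro ⟨g, w⟩ ⟨g', w'⟩
    simp only [TensCross.basis_apply]
    refine hπ.toIsLinearCocycle.normalOrder_relator_of_word b
      (hπ.normalOrder_word_relator b hρ _)
      (mul_mem_tensDeg ρ (word_mem_tensDeg ρ b w) (grp_mem_tensDeg ρ g))
      (mul_mem_tensDeg ρ (word_mem_tensDeg ρ b w') (grp_mem_tensDeg ρ g')) rfl x y
  have key : ((LinearMap.mul ℝ (TensCross ρ)).compl₁₂
      (LinearMap.mulRight ℝ (relator ρ π x y)) LinearMap.id).compr₂ (normalOrder ρ π b) = 0 :=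
    (TensCross.basis ρ b).ext fun i => (TensCross.basis ρ b).ext fun j => h i j
  exact LinearMap.congr_fun (LinearMap.congr_fun key p) q

omit [FiniteDimensional ℝ V]

/-- Each swap leaves the symbol unchanged and adds only terms of lower degree, while a sorted word
is sent to its symbol. Hence the nested induction on length and inversions. -/
theorem normalOrder_word_sub_mem_degLT (w : List κ) :
    normalOrder ρ π b (word ρ b w) - toSymCross ρ (word ρ b w) ∈
      SymCross.degLT ρ b w.length := by
  obtain ⟨n, hn⟩ : ∃ n, w.length = n := ⟨_, rfl⟩
  induction n generalizing w with
  | zero =>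
    rw [normalOrder, wordExtend_word, hn, orderedValue, sub_self]
    exact zero_mem _
  | succ k ih =>
    obtain ⟨N, hN⟩ : ∃ N, inversions w = N := ⟨_, rfl⟩
    induction N using Nat.strong_induction_on generalizing w with
    | _ N ihN =>
    have hval : ∀ w : List κ, w.length = k + 1 → normalOrder ρ π b (word ρ b w) =
        sortValue (sortCost ρ π b (orderedValue ρ π b k)) (fun w => toSymCross ρ (word ρ b w))
          w := by
      intro w hw
      rw [normalOrder, wordExtend_word, hw]
      rfl
    by_cases h : ∃ l j i r, IsDescent w l j i r
    · obtain ⟨l, j, i, r, ⟨rfl, hij⟩, h⟩ := exists_sortValue_eq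
        (D := sortCost ρ π b (orderedValue ρ π b k))
        (base := fun w => toSymCross ρ (word ρ b w)) h
      have hn' : (l ++ i :: j :: r).length = k + 1 := by simpa using hn
      rw [hval _ hn, h, ← hval _ hn', sortCost_orderedValue ρ π b l j i r hn]
      have h1 := ihN _ (hN ▸ inversions_swap_lt l r hij) _ hn' rfl
      have h2 : ∀ p ∈ tensDeg ρ k, normalOrder ρ π b p ∈ SymCross.degLT ρ b (k + 1) := by
        intro p hp
        refine tensDeg_induction ρ b
          (P := fun p => normalOrder ρ π b p ∈ SymCross.degLT ρ b (k + 1)) ?_ ?_ ?_ ?_ hp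
        · rw [map_zero]
          exact zero_mem _
        · intro p q hp hq
          rw [map_add]
          exact add_mem hp hq
        · intro r p hp
          rw [map_smul]
          exact Submodule.smul_mem _ _ hp
        · intro w g hw
          rw [normalOrder_mul_grp]
          refine SymCross.mul_grp_mem_degLT ρ b ?_ g
          have h3 := ih w hw
          rw [hw] at h3
          have h4 := SymCross.toSymCross_mem_degLT ρ b (m := k) (Nat.lt_succ_self k)
            (hw ▸ word_mem_tensDeg ρ b w)
          have h5 := add_mem (SymCross.degLT_mono ρ b (Nat.le_succ k) h3) h4
          rwa [sub_add_cancel] at h5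
      have h6 := word_mul_bracket_mul_word_mem_tensDeg ρ π b l r (b j) (b i)
      have h7 : l.length + 1 + r.length = k := by
        simp at hn
        omega
      rw [h7] at h6
      have h8 : toSymCross ρ (word ρ b (l ++ i :: j :: r)) =
          toSymCross ρ (word ρ b (l ++ j :: i :: r)) := by
        have e1 := SymCross.basis_coe ρ b 1 (l ++ i :: j :: r)
        have e2 := SymCross.basis_coe ρ b 1 (l ++ j :: i :: r)
        rw [grp_one, mul_one] at e1 e2
        rw [← e1, ← e2, Multiset.coe_eq_coe.2 (List.Perm.append_left l (List.Perm.swap j i r))]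
      rw [hn', h8] at h1
      rw [hn, add_sub_right_comm]
      exact add_mem h1 (h2 _ h6)
    · push Not at h
      rw [hval w hn, sortValue_of_sorted h, sub_self]
      exact zero_mem _

theorem normalOrder_sub_mem_degLT {n : ℕ} {p : TensCross ρ} (hp : p ∈ tensDeg ρ n) :
    normalOrder ρ π b p - toSymCross ρ p ∈ SymCross.degLT ρ b n := by
  refine tensDeg_induction ρ b
    (P := fun p => normalOrder ρ π b p - toSymCrossₗ ρ p ∈ SymCross.degLT ρ b n) ?_ ?_ ?_ ?_ hp
  · rw [map_zero, map_zero, sub_zero]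
    exact zero_mem _
  · intro p q hp hq
    rw [map_add, map_add, add_sub_add_comm]
    exact add_mem hp hq
  · intro r p hp
    rw [map_smul, map_smul, ← smul_sub]
    exact Submodule.smul_mem _ _ hp
  · intro w g hw
    have h := SymCross.mul_grp_mem_degLT ρ b (normalOrder_word_sub_mem_degLT (π := π) b w) g
    rwa [hw, sub_mul, ← normalOrder_mul_grp, word_eq_single, ← toSymCrossₗ_apply,
      toSymCrossₗ_single, SymCross.single_mul_grp, one_mul, ← word_eq_single,
      ← toSymCrossₗ_single, ← word_mul_grp] at h

end NormalOrder

open TensCross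

/-! ### Multiplicativity of the symbol map and equivariant sections -/

section Symbols

variable {Γ V : Type*} [Group Γ] [AddCommGroup V] [Module ℝ V] (ρ : Representation ℝ Γ V)

theorem TensV.toSym_smul (g : Γ) (t : TensV ρ) :
    TensV.toSym ρ (g • t) = g • TensV.toSym ρ t := by
  have h : (TensV.toSym ρ).comp (TensV.act ρ g) = (SymV.act ρ g).comp (TensV.toSym ρ) := by
    refine TensorAlgebra.hom_ext (LinearMap.ext fun x => ?_)
    change TensV.toSym ρ (TensV.act ρ g (TensV.ι ρ x)) = SymV.act ρ g (SymV.ι ρ x)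
    rw [TensV.act_ι, SymV.act_ι]
    rfl
  exact DFunLike.congr_fun h t

theorem TensCross.toSymCrossₗ_mul (p q : TensCross ρ) :
    toSymCrossₗ ρ (p * q) = toSymCrossₗ ρ p * toSymCrossₗ ρ q := by
  have key : (LinearMap.mul ℝ (TensCross ρ)).compr₂ (toSymCrossₗ ρ) =
      (LinearMap.mul ℝ (SymCross ρ)).compl₁₂ (toSymCrossₗ ρ) (toSymCrossₗ ρ) := by
    refine SkewMonoidAlgebra.lhom_ext fun g t => LinearMap.ext fun q => ?_
    refine LinearMap.congr_fun (f := ((LinearMap.mul ℝ (TensCross ρ)).compr₂ (toSymCrossₗ ρ))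
      (SkewMonoidAlgebra.single g t)) (SkewMonoidAlgebra.lhom_ext fun h u => ?_) q
    simp only [LinearMap.compr₂_apply, LinearMap.compl₁₂_apply, LinearMap.mul_apply',
      SkewMonoidAlgebra.single_mul_single, toSymCrossₗ_single, map_mul, TensV.toSym_smul]
  exact LinearMap.congr_fun (LinearMap.congr_fun key p) q

theorem TensCross.toSymCrossₗ_grp (g : Γ) : toSymCrossₗ ρ (grp ρ g) = SymCross.grp ρ g := by
  rw [grp, toSymCrossₗ_single, map_one, SymCross.grp]

theorem TensCross.toSymCrossₗ_vec (x : Module.Dual ℝ V) (g : Γ) :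
    toSymCrossₗ ρ (vec ρ x g) = SymCross.vec ρ x g := by
  rw [vec, toSymCrossₗ_single, SymCross.vec]
  rfl

/-- The component of `S(V*) ⋊ Γ` of polynomial degree `n`. -/
def symDeg (n : ℕ) : Submodule ℝ (SymCross ρ) := (tensDeg ρ n).map (toSymCrossₗ ρ)

theorem SymCross.mul_mem_symDeg {m n : ℕ} {a c : SymCross ρ} (ha : a ∈ symDeg ρ m)
    (hc : c ∈ symDeg ρ n) : a * c ∈ symDeg ρ (m + n) := by
  obtain ⟨p, hp, rfl⟩ := ha
  obtain ⟨q, hq, rfl⟩ := hc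
  exact ⟨p * q, mul_mem_tensDeg ρ hp hq, toSymCrossₗ_mul ρ p q⟩

theorem SymCross.grp_mem_symDeg (g : Γ) : SymCross.grp ρ g ∈ symDeg ρ 0 :=
  ⟨TensCross.grp ρ g, grp_mem_tensDeg ρ g, toSymCrossₗ_grp ρ g⟩

theorem SymCross.vec_mem_symDeg (x : Module.Dual ℝ V) (g : Γ) :
    SymCross.vec ρ x g ∈ symDeg ρ 1 := by
  rw [← toSymCrossₗ_vec, ← vecHom_mul_grp]
  exact ⟨_, mul_mem_tensDeg ρ (vecHom_mem_tensDeg ρ x) (grp_mem_tensDeg ρ g), rfl⟩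

variable {κ : Type*} [DecidableEq κ] (b : Module.Basis κ ℝ (Module.Dual ℝ V))

theorem SymCross.basis_mem_symDeg (i : Σ _ : Γ, Multiset κ) :
    SymCross.basis ρ b i ∈ symDeg ρ i.2.card := by
  obtain ⟨g, m⟩ := i
  obtain ⟨w, rfl⟩ := Quot.exists_rep m
  exact ⟨_, mul_mem_tensDeg ρ (word_mem_tensDeg ρ b w) (grp_mem_tensDeg ρ g),
    (SymCross.basis_coe ρ b g w).symm⟩

theorem SymCross.proj_of_mem_symDeg (k : ℤ) {n : ℕ} {a : SymCross ρ} (ha : a ∈ symDeg ρ n) :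
    SymCross.proj ρ b k a = if (n : ℤ) = k then a else 0 := by
  obtain ⟨p, hp, rfl⟩ := ha
  exact proj_toSymCross ρ b k hp

theorem SymCross.symDeg_le_degLT {m n : ℕ} (h : m < n) : symDeg ρ m ≤ SymCross.degLT ρ b n := by
  rintro _ ⟨p, hp, rfl⟩
  exact toSymCross_mem_degLT ρ b h hp

/-- The linear section of the symbol map sending a monomial to one of its words. -/
def wordSection : SymCross ρ →ₗ[ℝ] TensCross ρ :=
  (SymCross.basis ρ b).constr ℝ fun i => word ρ b i.2.toList * grp ρ i.1

theorem wordSection_basis (g : Γ) (m : Multiset κ) :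
    wordSection ρ b (SymCross.basis ρ b ⟨g, m⟩) = word ρ b m.toList * grp ρ g :=
  Module.Basis.constr_basis _ _ _ _

theorem toSymCrossₗ_wordSection (a : SymCross ρ) : toSymCrossₗ ρ (wordSection ρ b a) = a := by
  have h : toSymCrossₗ ρ ∘ₗ wordSection ρ b = LinearMap.id := by
    refine (SymCross.basis ρ b).ext fun ⟨g, m⟩ => ?_
    rw [LinearMap.comp_apply, wordSection_basis, toSymCrossₗ_apply, ← SymCross.basis_coe,
      Multiset.coe_toList, LinearMap.id_apply]
  exact LinearMap.congr_fun h a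

theorem wordSection_mul_grp (a : SymCross ρ) (h : Γ) :
    wordSection ρ b (a * SymCross.grp ρ h) = wordSection ρ b a * grp ρ h := by
  have key : wordSection ρ b ∘ₗ LinearMap.mulRight ℝ (SymCross.grp ρ h) =
      LinearMap.mulRight ℝ (grp ρ h) ∘ₗ wordSection ρ b := by
    refine (SymCross.basis ρ b).ext fun ⟨g, m⟩ => ?_
    simp only [LinearMap.comp_apply, LinearMap.mulRight_apply]
    rw [SymCross.basis_apply, SymCross.single_mul_grp, ← SymCross.basis_apply,
      ← SymCross.basis_apply, wordSection_basis, wordSection_basis, mul_assoc, grp_mul_grp]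
  exact LinearMap.congr_fun key a

theorem wordSection_mem_tensDeg {n : ℕ} {a : SymCross ρ} (ha : a ∈ symDeg ρ n) :
    wordSection ρ b a ∈ tensDeg ρ n := by
  obtain ⟨p, hp, rfl⟩ := ha
  refine tensDeg_induction ρ b
    (P := fun p => wordSection ρ b (toSymCrossₗ ρ p) ∈ tensDeg ρ n) ?_ ?_ ?_ ?_ hp
  · rw [map_zero, map_zero]
    exact zero_mem _
  · intro p q hp hq
    rw [map_add, map_add]
    exact add_mem hp hq
  · intro r p hp
    rw [map_smul, map_smul]
    exact Submodule.smul_mem _ _ hp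
  · intro w g hw
    rw [toSymCrossₗ_apply, ← SymCross.basis_coe, wordSection_basis]
    have h := mul_mem_tensDeg ρ (word_mem_tensDeg ρ b (w : Multiset κ).toList)
      (grp_mem_tensDeg ρ g)
    rwa [Multiset.length_toList, Multiset.coe_card, hw] at h

theorem wordSection_grp (g : Γ) : wordSection ρ b (SymCross.grp ρ g) = grp ρ g := by
  have h := SymCross.basis_coe ρ b g []
  rw [word_nil, one_mul, ← toSymCrossₗ_apply, toSymCrossₗ_grp] at h
  rw [← h, wordSection_basis, Multiset.coe_nil, Multiset.toList_zero, word_nil, one_mul]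

theorem wordSection_vec (x : Module.Dual ℝ V) : wordSection ρ b (SymCross.vec ρ x 1) =
    vecHom ρ x := by
  have h : wordSection ρ b ∘ₗ toSymCrossₗ ρ ∘ₗ vecHom ρ = vecHom ρ := by
    refine b.ext fun i => ?_
    have h := SymCross.basis_coe ρ b 1 [i]
    have h' : word ρ b [i] = vecHom ρ (b i) := by simp [word]
    rw [grp_one, mul_one, h', ← toSymCrossₗ_apply] at h
    rw [LinearMap.comp_apply, LinearMap.comp_apply, ← h, wordSection_basis,
      Multiset.coe_singleton, Multiset.toList_singleton, h', grp_one, mul_one]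
  have h2 := LinearMap.congr_fun h x
  rwa [LinearMap.comp_apply, LinearMap.comp_apply, ← vec_one, toSymCrossₗ_vec] at h2

variable [Fintype Γ]

/-- The average of `wordSection` over `Γ`, a `Γ`-bilinear section of the symbol map. -/
def equivariantSection : SymCross ρ →ₗ[ℝ] TensCross ρ :=
  (Fintype.card Γ : ℝ)⁻¹ • ∑ h : Γ, LinearMap.mulLeft ℝ (grp ρ h) ∘ₗ wordSection ρ b ∘ₗ
    LinearMap.mulLeft ℝ (SymCross.grp ρ h⁻¹)

theorem equivariantSection_apply (a : SymCross ρ) : equivariantSection ρ b a =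
    (Fintype.card Γ : ℝ)⁻¹ • ∑ h : Γ, grp ρ h * wordSection ρ b (SymCross.grp ρ h⁻¹ * a) := by
  simp [equivariantSection, LinearMap.sum_apply]

theorem inv_card_smul_sum_const {M : Type*} [AddCommGroup M] [Module ℝ M] (x : M) :
    (Fintype.card Γ : ℝ)⁻¹ • ∑ _h : Γ, x = x := by
  rw [Finset.sum_const, Finset.card_univ, ← Nat.cast_smul_eq_nsmul ℝ, smul_smul,
    inv_mul_cancel₀ (by exact_mod_cast Fintype.card_ne_zero), one_smul]

theorem toSymCrossₗ_equivariantSection (a : SymCross ρ) :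
    toSymCrossₗ ρ (equivariantSection ρ b a) = a := by
  rw [equivariantSection_apply, map_smul, map_sum]
  simp only [toSymCrossₗ_mul, toSymCrossₗ_grp, toSymCrossₗ_wordSection, ← mul_assoc,
    SymCross.grp_mul_grp, mul_inv_cancel, SymCross.grp_one, one_mul]
  exact inv_card_smul_sum_const a

theorem equivariantSection_mul_grp (a : SymCross ρ) (h : Γ) :
    equivariantSection ρ b (a * SymCross.grp ρ h) = equivariantSection ρ b a * grp ρ h := by
  rw [equivariantSection_apply, equivariantSection_apply, smul_mul_assoc, Finset.sum_mul]
  simp only [← mul_assoc, wordSection_mul_grp]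

/-- Left multiplication by g permutes the summands of the average. `wordSection`, which depends on a
basis, need not be left Γ-linear. -/
theorem equivariantSection_grp_mul (g : Γ) (a : SymCross ρ) :
    equivariantSection ρ b (SymCross.grp ρ g * a) = grp ρ g * equivariantSection ρ b a := by
  rw [equivariantSection_apply, equivariantSection_apply, mul_smul_comm, Finset.mul_sum,
    ← Equiv.sum_comp (Equiv.mulLeft g)]
  simp only [← mul_assoc, SymCross.grp_mul_grp, grp_mul_grp, Equiv.coe_mulLeft, mul_inv_rev,
    inv_mul_cancel_right]

theorem equivariantSection_mem_tensDeg {n : ℕ} {a : SymCross ρ} (ha : a ∈ symDeg ρ n) :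
    equivariantSection ρ b a ∈ tensDeg ρ n := by
  rw [equivariantSection_apply]
  refine Submodule.smul_mem _ _ (Submodule.sum_mem _ fun h _ => ?_)
  have h1 := SymCross.mul_mem_symDeg ρ (SymCross.grp_mem_symDeg ρ h⁻¹) ha
  have h2 := mul_mem_tensDeg ρ (grp_mem_tensDeg ρ h) (wordSection_mem_tensDeg ρ b h1)
  rwa [zero_add, zero_add] at h2

theorem equivariantSection_one : equivariantSection ρ b 1 = 1 := by
  rw [equivariantSection_apply]
  simp only [mul_one, wordSection_grp, grp_mul_grp, mul_inv_cancel]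
  exact inv_card_smul_sum_const (M := TensCross ρ) 1

theorem equivariantSection_grp (g : Γ) :
    equivariantSection ρ b (SymCross.grp ρ g) = grp ρ g := by
  have h := equivariantSection_grp_mul ρ b g 1
  rwa [mul_one, equivariantSection_one, mul_one] at h

/-- In degree one `wordSection` is already the canonical inclusion, so averaging changes nothing.
This keeps the commutation relations exact after transport. -/
theorem equivariantSection_vec (x : Module.Dual ℝ V) (g : Γ) :
    equivariantSection ρ b (SymCross.vec ρ x g) = vec ρ x g := by
  have h1 : ∀ x g, SymCross.vec ρ x g = SymCross.vec ρ x 1 * SymCross.grp ρ g := fun x g => by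
    rw [← toSymCrossₗ_vec, ← toSymCrossₗ_vec, ← toSymCrossₗ_grp, ← toSymCrossₗ_mul, vec_one,
      vecHom_mul_grp]
  have h2 : ∀ g, SymCross.grp ρ g * SymCross.vec ρ x 1 =
      SymCross.vec ρ (ρ.dual g x) 1 * SymCross.grp ρ g := fun g => by
    rw [← toSymCrossₗ_vec, ← toSymCrossₗ_vec, ← toSymCrossₗ_grp, ← toSymCrossₗ_mul,
      ← toSymCrossₗ_mul, vec_one, vec_one, grp_mul_vecHom]
  rw [h1, equivariantSection_mul_grp, ← vecHom_mul_grp, equivariantSection_apply]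
  congr 1
  have h3 : ∀ h : Γ, grp ρ h * (vecHom ρ (ρ.dual h⁻¹ x) * grp ρ h⁻¹) = vecHom ρ x := fun h => by
    rw [← mul_assoc, grp_mul_vecHom, mul_assoc, grp_mul_grp, mul_inv_cancel, grp_one, mul_one,
      ← Module.End.mul_apply, ← map_mul, mul_inv_cancel, map_one, Module.End.one_apply]
  simp only [h2, wordSection_mul_grp, wordSection_vec, h3]
  exact inv_card_smul_sum_const (vecHom ρ x)

end Symbols

/-! ### The PBW property -/

section PBW

variable {Γ V : Type*} [CommGroup Γ] [Fintype Γ] [AddCommGroup V] [Module ℝ V]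
  {ρ : Representation ℝ Γ V} {π : LinearCochain Γ V}

theorem QuotAlg.mk_surjective : Function.Surjective (QuotAlg.mk ρ π) :=
  RingQuot.mkAlgHom_surjective ℝ (Rel ρ π)

theorem QuotAlg.mk_relator (x y : Module.Dual ℝ V) : QuotAlg.mk ρ π (relator ρ π x y) = 0 := by
  have h := RingQuot.mkAlgHom_rel ℝ (Rel.comm (ρ := ρ) (π := π) x y)
  rw [vec_one, vec_one] at h
  rw [relator_apply, sub_sub, map_sub, sub_eq_zero, QuotAlg.mk, h, bracket_apply]
  simp only [vecHom_mul_grp]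

theorem QuotAlg.mk_mem_filtLT {k n : ℕ} (h : k < n) {p : TensCross ρ} (hp : p ∈ tensDeg ρ k) :
    QuotAlg.mk ρ π p ∈ QuotAlg.filtLT ρ π n :=
  ⟨p, Submodule.mem_iSup_of_mem k (Submodule.mem_iSup_of_mem h hp), rfl⟩

theorem QuotAlg.filtLT_le {n : ℕ} {S : Submodule ℝ (QuotAlg ρ π)}
    (h : ∀ k < n, ∀ p ∈ tensDeg ρ k, QuotAlg.mk ρ π p ∈ S) : QuotAlg.filtLT ρ π n ≤ S := by
  rw [QuotAlg.filtLT, Submodule.map_le_iff_le_comap]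
  exact iSup_le fun k => iSup_le fun hk p hp => h k hk p hp

theorem QuotAlg.filtLT_mono {m n : ℕ} (h : m ≤ n) :
    QuotAlg.filtLT ρ π m ≤ QuotAlg.filtLT ρ π n :=
  QuotAlg.filtLT_le fun _ hk _ hp => QuotAlg.mk_mem_filtLT (hk.trans_le h) hp

theorem QuotAlg.mul_mem_filtLT {m n : ℕ} {p : TensCross ρ} (hp : p ∈ tensDeg ρ m)
    {a : QuotAlg ρ π} (ha : a ∈ QuotAlg.filtLT ρ π n) :
    QuotAlg.mk ρ π p * a ∈ QuotAlg.filtLT ρ π (m + n) := by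
  have h : QuotAlg.filtLT ρ π n ≤
      (QuotAlg.filtLT ρ π (m + n)).comap (LinearMap.mulLeft ℝ (QuotAlg.mk ρ π p)) := by
    refine QuotAlg.filtLT_le fun k hk q hq => ?_
    rw [Submodule.mem_comap, LinearMap.mulLeft_apply, ← map_mul]
    exact QuotAlg.mk_mem_filtLT (Nat.add_lt_add_left hk m) (mul_mem_tensDeg ρ hp hq)
  exact h ha

theorem QuotAlg.mul_grp_mem_filtLT {n : ℕ} {a : QuotAlg ρ π} (ha : a ∈ QuotAlg.filtLT ρ π n)
    (g : Γ) : a * QuotAlg.mk ρ π (grp ρ g) ∈ QuotAlg.filtLT ρ π n := by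
  have h : QuotAlg.filtLT ρ π n ≤ (QuotAlg.filtLT ρ π n).comap
      (LinearMap.mulRight ℝ (QuotAlg.mk ρ π (grp ρ g))) := by
    refine QuotAlg.filtLT_le fun k hk q hq => ?_
    rw [Submodule.mem_comap, LinearMap.mulRight_apply, ← map_mul]
    exact QuotAlg.mk_mem_filtLT hk (mul_mem_tensDeg ρ hq (grp_mem_tensDeg ρ g))
  exact h ha

variable {κ : Type*} (b : Module.Basis κ ℝ (Module.Dual ℝ V))

theorem QuotAlg.mk_word_sub_mem_filtLT {w w' : List κ} (h : w.Perm w') :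
    QuotAlg.mk ρ π (word ρ b w) - QuotAlg.mk ρ π (word ρ b w') ∈
      QuotAlg.filtLT ρ π w.length := by
  induction h with
  | nil => rw [sub_self]; exact zero_mem _
  | cons i h ih =>
    rw [word_cons, word_cons, map_mul, map_mul, ← mul_sub, List.length_cons, add_comm]
    exact QuotAlg.mul_mem_filtLT (vecHom_mem_tensDeg ρ _) ih
  | swap i j w =>
    have h1 : QuotAlg.mk ρ π (word ρ b (j :: i :: w)) - QuotAlg.mk ρ π (word ρ b (i :: j :: w)) =
        QuotAlg.mk ρ π (bracket ρ π (b j) (b i) * word ρ b w) := by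
      rw [← sub_eq_zero, ← map_sub, ← map_sub,
        ← zero_mul (QuotAlg.mk ρ π (word ρ b w)), ← QuotAlg.mk_relator (b j) (b i), ← map_mul,
        relator_apply]
      congr 1
      simp only [word_cons]
      noncomm_ring
    rw [h1]
    refine QuotAlg.mk_mem_filtLT ?_
      (mul_mem_tensDeg ρ (bracket_mem_tensDeg _ _) (word_mem_tensDeg ρ b w))
    simp only [List.length_cons]
    omega
  | trans h1 h2 ih1 ih2 =>
    rw [← sub_add_sub_cancel]
    exact add_mem ih1 (h1.length_eq ▸ ih2)

theorem QuotAlg.mk_sub_mk_wordSection_mem_filtLT [DecidableEq κ] {n : ℕ} {p : TensCross ρ}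
    (hp : p ∈ tensDeg ρ n) :
    QuotAlg.mk ρ π p - QuotAlg.mk ρ π (wordSection ρ b (toSymCrossₗ ρ p)) ∈
      QuotAlg.filtLT ρ π n := by
  refine tensDeg_induction ρ b (P := fun p => QuotAlg.mk ρ π p -
    QuotAlg.mk ρ π (wordSection ρ b (toSymCrossₗ ρ p)) ∈ QuotAlg.filtLT ρ π n) ?_ ?_ ?_ ?_ hp
  · simp
  · intro p q hp hq
    simp only [map_add, add_sub_add_comm]
    exact add_mem hp hq
  · intro r p hp
    simp only [map_smul]
    convert Submodule.smul_mem _ r hp using 1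
    module
  · intro w g hw
    rw [toSymCrossₗ_apply, ← SymCross.basis_coe, wordSection_basis, map_mul, map_mul, ← sub_mul]
    refine QuotAlg.mul_grp_mem_filtLT ?_ g
    rw [← hw]
    refine QuotAlg.mk_word_sub_mem_filtLT b (Multiset.coe_eq_coe.1 ?_)
    rw [Multiset.coe_toList]

theorem QuotAlg.mk_mem_filtLT_of_toSymCross_eq_zero [FiniteDimensional ℝ V] {n : ℕ}
    {p : TensCross ρ} (hp : p ∈ tensDeg ρ n) (h : toSymCrossₗ ρ p = 0) :
    QuotAlg.mk ρ π p ∈ QuotAlg.filtLT ρ π n := by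
  have h1 := QuotAlg.mk_sub_mk_wordSection_mem_filtLT (π := π)
    (Module.finBasis ℝ (Module.Dual ℝ V)) hp
  rwa [h, map_zero, map_zero, sub_zero] at h1

variable [FiniteDimensional ℝ V] [LinearOrder κ]

theorem IsLinearPoisson.normalOrder_eq_of_mk_eq (hρ : Function.Injective ρ)
    (hπ : IsLinearPoisson ρ π) {p q : TensCross ρ} (h : QuotAlg.mk ρ π p = QuotAlg.mk ρ π q) :
    normalOrder ρ π b p = normalOrder ρ π b q := by
  -- `normalOrder` is linear but not multiplicative, so it cannot be lifted to the quotient algebra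
  -- directly. Quantifying over all multipliers `u`, `v` gives a ring congruence containing the
  -- relations.
  let c : RingCon (TensCross ρ) :=
    { r := fun p q => ∀ u v, normalOrder ρ π b (u * p * v) = normalOrder ρ π b (u * q * v)
      iseqv := ⟨fun _ _ _ => rfl, fun h u v => (h u v).symm,
        fun h h' u v => (h u v).trans (h' u v)⟩
      mul' := fun {p p' q q'} h h' u v => by
        have h1 := h u (q * v)
        have h2 := h' (u * p') v
        simp only [← mul_assoc] at h1 h2 ⊢
        exact h1.trans h2
      add' := fun {p p' q q'} h h' u v => by
        rw [mul_add, add_mul, map_add, h, h', mul_add, add_mul, map_add] }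
  have hrel : ∀ ⦃p q⦄, Rel ρ π p q → c.mk' p = c.mk' q := by
    rintro _ _ ⟨x, y⟩
    refine (RingCon.eq c).2 fun u v => ?_
    have h1 := hπ.normalOrder_relator b hρ u v x y
    rw [relator_apply, sub_sub, mul_sub, sub_mul, map_sub, sub_eq_zero, bracket_apply] at h1
    simp only [vecHom_mul_grp] at h1
    exact h1
  have h1 : c.mk' p = c.mk' q := by
    have h2 : RingQuot.mkRingHom (Rel ρ π) p = RingQuot.mkRingHom (Rel ρ π) q := by
      rw [← RingQuot.mkAlgHom_coe ℝ]
      exact h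
    have h3 := congrArg (RingQuot.lift ⟨c.mk', hrel⟩) h2
    rwa [RingQuot.lift_mkRingHom_apply, RingQuot.lift_mkRingHom_apply] at h3
  have h4 := (RingCon.eq c).1 h1 1 1
  rwa [one_mul, one_mul, mul_one, mul_one] at h4

omit [FiniteDimensional ℝ V] in
theorem normalOrder_mem_degLT {n : ℕ} {p : TensCross ρ}
    (hp : p ∈ ⨆ (k : ℕ) (_ : k < n), tensDeg ρ k) :
    normalOrder ρ π b p ∈ SymCross.degLT ρ b n := by
  have h : (⨆ (k : ℕ) (_ : k < n), tensDeg ρ k) ≤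
      (SymCross.degLT ρ b n).comap (normalOrder ρ π b) := by
    refine iSup_le fun k => iSup_le fun hk p hp => ?_
    have h1 := SymCross.degLT_mono ρ b hk.le (normalOrder_sub_mem_degLT (π := π) b hp)
    have h2 := add_mem h1 (SymCross.toSymCross_mem_degLT ρ b hk hp)
    rwa [sub_add_cancel] at h2
  exact h hp

/-- If `p` of degree n equals some `q` of lower degree in A_π, both have the same normal form. That
form is the symbol of `p` up to lower degree, so the symbol is homogeneous of degree n and of degree
below n, hence zero. -/
theorem IsLinearPoisson.hasPBW (hρ : Function.Injective ρ) (hπ : IsLinearPoisson ρ π) :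
    HasPBW ρ π := by
  intro n p hp
  refine ⟨?_, fun h => QuotAlg.mk_mem_filtLT_of_toSymCross_eq_zero hp h⟩
  rintro ⟨q, hq, h⟩
  let b := Module.finBasis ℝ (Module.Dual ℝ V)
  have h1 := hπ.normalOrder_eq_of_mk_eq b hρ h
  have h2 := normalOrder_sub_mem_degLT (π := π) b hp
  have h3 := sub_mem (normalOrder_mem_degLT (π := π) b hq) h2
  rw [h1, sub_sub_cancel] at h3
  exact SymCross.eq_zero_of_toSymCross_mem_degLT ρ b hp h3

end PBW

/-! ### Transport of the product to `S(V*) ⋊ Γ` -/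

section Transport

variable {Γ V : Type*} [CommGroup Γ] [Fintype Γ] [AddCommGroup V] [Module ℝ V]
  [FiniteDimensional ℝ V] {ρ : Representation ℝ Γ V} {π : LinearCochain Γ V}
  {κ : Type*} [LinearOrder κ] (b : Module.Basis κ ℝ (Module.Dual ℝ V))

/-- The `Γ`-bilinear linear map `S(V*) ⋊ Γ → A_π` given by an equivariant section. -/
def quantMap (ρ : Representation ℝ Γ V) (π : LinearCochain Γ V)
    (b : Module.Basis κ ℝ (Module.Dual ℝ V)) : SymCross ρ →ₗ[ℝ] QuotAlg ρ π :=
  (QuotAlg.mk ρ π).toLinearMap ∘ₗ equivariantSection ρ b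

omit [FiniteDimensional ℝ V] in
theorem quantMap_apply (a : SymCross ρ) :
    quantMap ρ π b a = QuotAlg.mk ρ π (equivariantSection ρ b a) := rfl

theorem mk_sub_quantMap_mem_filtLT {n : ℕ} {p : TensCross ρ} (hp : p ∈ tensDeg ρ n) :
    QuotAlg.mk ρ π p - quantMap ρ π b (toSymCrossₗ ρ p) ∈ QuotAlg.filtLT ρ π n := by
  rw [quantMap_apply, ← map_sub]
  refine QuotAlg.mk_mem_filtLT_of_toSymCross_eq_zero
    (sub_mem hp (equivariantSection_mem_tensDeg ρ b ⟨p, hp, rfl⟩)) ?_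
  rw [map_sub, toSymCrossₗ_equivariantSection, sub_self]

/-- Subtracting the image of the symbol lowers the filtration degree, and induction absorbs the
rest; this yields surjectivity. -/
theorem QuotAlg.filtLT_le_map_quantMap (n : ℕ) :
    QuotAlg.filtLT ρ π n ≤ (SymCross.degLT ρ b n).map (quantMap ρ π b) := by
  induction n with
  | zero => exact QuotAlg.filtLT_le fun k hk => absurd hk (Nat.not_lt_zero k)
  | succ n ih =>
    refine QuotAlg.filtLT_le fun k hk p hp => ?_
    have h1 := QuotAlg.filtLT_mono (Nat.lt_succ_iff.1 hk) (mk_sub_quantMap_mem_filtLT (π := π) b hp)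
    have h2 := Submodule.map_mono (SymCross.degLT_mono ρ b (Nat.le_succ n)) (ih h1)
    have h3 : quantMap ρ π b (toSymCrossₗ ρ p) ∈
        (SymCross.degLT ρ b (n + 1)).map (quantMap ρ π b) :=
      ⟨_, SymCross.toSymCross_mem_degLT ρ b hk hp, rfl⟩
    have h4 := add_mem h2 h3
    rwa [sub_add_cancel] at h4

omit [FiniteDimensional ℝ V] [Fintype Γ] in
theorem SymCross.exists_mem_degLT (a : SymCross ρ) : ∃ n, a ∈ SymCross.degLT ρ b n := by
  induction (SymCross.basis ρ b).mem_span a using Submodule.span_induction with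
  | mem a ha =>
    obtain ⟨i, rfl⟩ := ha
    exact ⟨i.2.card + 1, Submodule.subset_span ⟨i.1, i.2, Nat.lt_succ_self _, rfl⟩⟩
  | zero => exact ⟨0, zero_mem _⟩
  | add x y _ _ hx hy =>
    obtain ⟨m, hm⟩ := hx
    obtain ⟨n, hn⟩ := hy
    exact ⟨max m n, add_mem (degLT_mono ρ b (le_max_left m n) hm)
      (degLT_mono ρ b (le_max_right m n) hn)⟩
  | smul r x _ hx =>
    obtain ⟨n, hn⟩ := hx
    exact ⟨n, Submodule.smul_mem _ _ hn⟩

omit [FiniteDimensional ℝ V] [Fintype Γ] in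
theorem SymCross.degLT_zero : SymCross.degLT ρ b 0 = ⊥ := by
  rw [SymCross.degLT, Submodule.span_eq_bot]
  rintro _ ⟨g, m, hm, rfl⟩
  exact absurd hm (Nat.not_lt_zero _)

omit [FiniteDimensional ℝ V] in
theorem normalOrder_equivariantSection_sub_mem_degLT {n : ℕ} {a : SymCross ρ}
    (ha : a ∈ SymCross.degLT ρ b (n + 1)) :
    normalOrder ρ π b (equivariantSection ρ b a) - a ∈ SymCross.degLT ρ b n := by
  induction ha using Submodule.span_induction with
  | mem a ha =>
    obtain ⟨g, m, hm, rfl⟩ := ha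
    have h := normalOrder_sub_mem_degLT (π := π) b
      (equivariantSection_mem_tensDeg ρ b (SymCross.basis_mem_symDeg ρ b ⟨g, m⟩))
    rw [← toSymCrossₗ_apply, toSymCrossₗ_equivariantSection] at h
    exact SymCross.degLT_mono ρ b (Nat.lt_succ_iff.1 hm) h
  | zero => simp
  | add x y _ _ hx hy =>
    rw [map_add, map_add, add_sub_add_comm]
    exact add_mem hx hy
  | smul r x _ hx =>
    rw [map_smul, map_smul, ← smul_sub]
    exact Submodule.smul_mem _ _ hx

/-- Normal ordering after the section is the identity up to lower degree and factors through
`quantMap`. An element of the kernel therefore drops in degree indefinitely. -/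
theorem IsLinearPoisson.quantMap_injective (hρ : Function.Injective ρ)
    (hπ : IsLinearPoisson ρ π) : Function.Injective (quantMap ρ π b) := by
  rw [injective_iff_map_eq_zero]
  intro a ha
  have h0 : normalOrder ρ π b (equivariantSection ρ b a) = 0 := by
    rw [quantMap_apply, ← map_zero (QuotAlg.mk ρ π)] at ha
    rw [hπ.normalOrder_eq_of_mk_eq b hρ ha, map_zero]
  have h1 : ∀ n, a ∈ SymCross.degLT ρ b n → a = 0 := by
    intro n
    induction n with
    | zero =>
      intro h
      rwa [SymCross.degLT_zero, Submodule.mem_bot] at h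
    | succ n ih =>
      intro h
      have h2 := normalOrder_equivariantSection_sub_mem_degLT (π := π) b h
      rw [h0, zero_sub, neg_mem_iff] at h2
      exact ih h2
  obtain ⟨n, hn⟩ := SymCross.exists_mem_degLT b a
  exact h1 n hn

omit [FiniteDimensional ℝ V] in
theorem QuotAlg.exists_mem_filtLT (a : QuotAlg ρ π) : ∃ n, a ∈ QuotAlg.filtLT ρ π n := by
  obtain ⟨p, rfl⟩ := QuotAlg.mk_surjective a
  induction (TensCross.basis ρ (Module.Free.chooseBasis ℝ (Module.Dual ℝ V))).mem_span p
    using Submodule.span_induction with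
  | mem p hp =>
    obtain ⟨⟨g, w⟩, rfl⟩ := hp
    rw [TensCross.basis_apply]
    exact ⟨_, QuotAlg.mk_mem_filtLT (Nat.lt_succ_self _)
      (mul_mem_tensDeg ρ (word_mem_tensDeg ρ _ w) (grp_mem_tensDeg ρ g))⟩
  | zero => exact ⟨0, by rw [map_zero]; exact zero_mem _⟩
  | add x y _ _ hx hy =>
    obtain ⟨m, hm⟩ := hx
    obtain ⟨n, hn⟩ := hy
    refine ⟨max m n, ?_⟩
    rw [map_add]
    exact add_mem (filtLT_mono (le_max_left m n) hm) (filtLT_mono (le_max_right m n) hn)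
  | smul r x _ hx =>
    obtain ⟨n, hn⟩ := hx
    refine ⟨n, ?_⟩
    rw [map_smul]
    exact Submodule.smul_mem _ _ hn

theorem quantMap_surjective : Function.Surjective (quantMap ρ π b) := by
  intro a
  obtain ⟨n, hn⟩ := QuotAlg.exists_mem_filtLT a
  obtain ⟨c, _, hc⟩ := QuotAlg.filtLT_le_map_quantMap b n hn
  exact ⟨c, hc⟩

/-- The linear isomorphism `S(V*) ⋊ Γ ≃ A_π`. -/
def IsLinearPoisson.quantEquiv (hρ : Function.Injective ρ) (hπ : IsLinearPoisson ρ π) :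
    SymCross ρ ≃ₗ[ℝ] QuotAlg ρ π :=
  LinearEquiv.ofBijective (quantMap ρ π b) ⟨hπ.quantMap_injective b hρ, quantMap_surjective b⟩

/-- The product of `A_π`, transported to `S(V*) ⋊ Γ`. -/
def IsLinearPoisson.star (hρ : Function.Injective ρ) (hπ : IsLinearPoisson ρ π) :
    SymCross ρ →ₗ[ℝ] SymCross ρ →ₗ[ℝ] SymCross ρ :=
  ((LinearMap.mul ℝ (QuotAlg ρ π)).compl₁₂ (quantMap ρ π b) (quantMap ρ π b)).compr₂
    (hπ.quantEquiv b hρ).symm.toLinearMap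

variable (hρ : Function.Injective ρ) (hπ : IsLinearPoisson ρ π)

theorem IsLinearPoisson.quantMap_star (a c : SymCross ρ) :
    quantMap ρ π b (hπ.star b hρ a c) = quantMap ρ π b a * quantMap ρ π b c :=
  (hπ.quantEquiv b hρ).apply_symm_apply _

theorem IsLinearPoisson.star_assoc (a c d : SymCross ρ) :
    hπ.star b hρ (hπ.star b hρ a c) d = hπ.star b hρ a (hπ.star b hρ c d) := by
  apply hπ.quantMap_injective b hρ
  simp only [hπ.quantMap_star b hρ, mul_assoc]

omit [FiniteDimensional ℝ V] in
theorem quantMap_grp_mul (g : Γ) (a : SymCross ρ) :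
    quantMap ρ π b (SymCross.grp ρ g * a) = quantMap ρ π b (SymCross.grp ρ g) *
      quantMap ρ π b a := by
  rw [quantMap_apply, quantMap_apply, quantMap_apply, ← map_mul, equivariantSection_grp_mul,
    equivariantSection_grp]

omit [FiniteDimensional ℝ V] in
theorem quantMap_mul_grp (a : SymCross ρ) (g : Γ) :
    quantMap ρ π b (a * SymCross.grp ρ g) = quantMap ρ π b a *
      quantMap ρ π b (SymCross.grp ρ g) := by
  rw [quantMap_apply, quantMap_apply, quantMap_apply, ← map_mul, equivariantSection_mul_grp,
    equivariantSection_grp]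

theorem IsLinearPoisson.star_grp_left (g : Γ) (a : SymCross ρ) :
    hπ.star b hρ (SymCross.grp ρ g) a = SymCross.grp ρ g * a := by
  apply hπ.quantMap_injective b hρ
  rw [hπ.quantMap_star, quantMap_grp_mul]

theorem IsLinearPoisson.star_grp_right (a : SymCross ρ) (g : Γ) :
    hπ.star b hρ a (SymCross.grp ρ g) = a * SymCross.grp ρ g := by
  apply hπ.quantMap_injective b hρ
  rw [hπ.quantMap_star, quantMap_mul_grp]

theorem IsLinearPoisson.star_vec_sub (x y : Module.Dual ℝ V) :
    hπ.star b hρ (SymCross.vec ρ x 1) (SymCross.vec ρ y 1) -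
      hπ.star b hρ (SymCross.vec ρ y 1) (SymCross.vec ρ x 1) =
      ∑ γ : Γ, SymCross.vec ρ (π γ x y) γ := by
  apply hπ.quantMap_injective b hρ
  rw [map_sub, hπ.quantMap_star, hπ.quantMap_star, map_sum]
  simp only [quantMap_apply, equivariantSection_vec, vec_one]
  have h := QuotAlg.mk_relator (ρ := ρ) (π := π) x y
  rw [relator_apply, map_sub, map_sub, map_mul, map_mul, sub_eq_zero] at h
  rw [h, bracket_apply, map_sum]
  simp only [vecHom_mul_grp]

theorem IsLinearPoisson.mem_degLT_of_quantMap_mem_filtLT (hρ : Function.Injective ρ)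
    (hπ : IsLinearPoisson ρ π) {n : ℕ} {a : SymCross ρ}
    (h : quantMap ρ π b a ∈ QuotAlg.filtLT ρ π n) : a ∈ SymCross.degLT ρ b n := by
  obtain ⟨c, hc, hac⟩ := QuotAlg.filtLT_le_map_quantMap b n h
  rwa [← hπ.quantMap_injective b hρ hac]

theorem IsLinearPoisson.star_sub_mul_mem_degLT {i j : ℕ} {a c : SymCross ρ}
    (ha : a ∈ symDeg ρ i) (hc : c ∈ symDeg ρ j) :
    hπ.star b hρ a c - a * c ∈ SymCross.degLT ρ b (i + j) := by
  apply hπ.mem_degLT_of_quantMap_mem_filtLT b hρ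
  have h := mk_sub_quantMap_mem_filtLT (π := π) b
    (mul_mem_tensDeg ρ (equivariantSection_mem_tensDeg ρ b ha)
      (equivariantSection_mem_tensDeg ρ b hc))
  rwa [toSymCrossₗ_mul, toSymCrossₗ_equivariantSection, toSymCrossₗ_equivariantSection,
    map_mul, ← quantMap_apply, ← quantMap_apply, ← hπ.quantMap_star b hρ, ← map_sub] at h

theorem IsLinearPoisson.star_mem_degLT {i j : ℕ} {a c : SymCross ρ}
    (ha : a ∈ symDeg ρ i) (hc : c ∈ symDeg ρ j) :
    hπ.star b hρ a c ∈ SymCross.degLT ρ b (i + j + 1) := by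
  have h1 := SymCross.degLT_mono ρ b (Nat.le_succ _) (hπ.star_sub_mul_mem_degLT b hρ ha hc)
  have h2 := SymCross.symDeg_le_degLT ρ b (Nat.lt_succ_self _) (SymCross.mul_mem_symDeg ρ ha hc)
  have h3 := add_mem h1 h2
  rwa [sub_add_cancel] at h3

theorem IsLinearPoisson.star_mem_degLT_left {i j : ℕ} {a c : SymCross ρ}
    (ha : a ∈ SymCross.degLT ρ b i) (hc : c ∈ symDeg ρ j) :
    hπ.star b hρ a c ∈ SymCross.degLT ρ b (i + j) := by
  induction ha using Submodule.span_induction with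
  | mem a ha =>
    obtain ⟨g, m, hm, rfl⟩ := ha
    refine SymCross.degLT_mono ρ b ?_
      (hπ.star_mem_degLT b hρ (SymCross.basis_mem_symDeg ρ b ⟨g, m⟩) hc)
    dsimp only
    omega
  | zero => simp
  | add x y _ _ hx hy =>
    rw [map_add, LinearMap.add_apply]
    exact add_mem hx hy
  | smul r x _ hx =>
    rw [map_smul, LinearMap.smul_apply]
    exact Submodule.smul_mem _ _ hx

theorem IsLinearPoisson.star_mem_degLT_right {i j : ℕ} {a c : SymCross ρ}
    (ha : a ∈ symDeg ρ i) (hc : c ∈ SymCross.degLT ρ b j) :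
    hπ.star b hρ a c ∈ SymCross.degLT ρ b (i + j) := by
  induction hc using Submodule.span_induction with
  | mem a hc =>
    obtain ⟨g, m, hm, rfl⟩ := hc
    refine SymCross.degLT_mono ρ b ?_
      (hπ.star_mem_degLT b hρ ha (SymCross.basis_mem_symDeg ρ b ⟨g, m⟩))
    dsimp only
    omega
  | zero => simp
  | add x y _ _ hx hy =>
    rw [map_add]
    exact add_mem hx hy
  | smul r x _ hx =>
    rw [map_smul]
    exact Submodule.smul_mem _ _ hx

end Transport

/-! ### Homogenization of the transported product -/

section Homogenize

variable {Γ V : Type*} [CommGroup Γ] [Fintype Γ] [AddCommGroup V] [Module ℝ V]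
  [FiniteDimensional ℝ V] {ρ : Representation ℝ Γ V} {π : LinearCochain Γ V}
  {κ : Type*} [LinearOrder κ] (b : Module.Basis κ ℝ (Module.Dual ℝ V))
  (hρ : Function.Injective ρ) (hπ : IsLinearPoisson ρ π)

/-- The coefficient of `ħⁿ`: the part of the transported product lowering the degree by `n`. -/
def IsLinearPoisson.coeffMul (n : ℕ) : SymCross ρ →ₗ[ℝ] SymCross ρ →ₗ[ℝ] SymCross ρ :=
  (SymCross.basis ρ b).constr ℝ fun i => (SymCross.basis ρ b).constr ℝ fun j =>
    SymCross.proj ρ b ((i.2.card : ℤ) + j.2.card - n)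
      (hπ.star b hρ (SymCross.basis ρ b i) (SymCross.basis ρ b j))

omit [FiniteDimensional ℝ V] [Fintype Γ] in
theorem SymCross.symDeg_le_span (n : ℕ) : symDeg ρ n ≤
    Submodule.span ℝ {a | ∃ i : Σ _ : Γ, Multiset κ, i.2.card = n ∧ a = SymCross.basis ρ b i} := by
  rintro _ ⟨p, hp, rfl⟩
  refine tensDeg_induction ρ b (P := fun p => toSymCrossₗ ρ p ∈ _) ?_ ?_ ?_ ?_ hp
  · rw [map_zero]
    exact zero_mem _
  · intro p q hp hq
    rw [map_add]
    exact add_mem hp hq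
  · intro r p hp
    rw [map_smul]
    exact Submodule.smul_mem _ _ hp
  · intro w g hw
    rw [toSymCrossₗ_apply, ← basis_coe]
    exact Submodule.subset_span ⟨⟨g, w⟩, hw, rfl⟩

theorem IsLinearPoisson.coeffMul_apply (n : ℕ) {i j : ℕ} {a c : SymCross ρ}
    (ha : a ∈ symDeg ρ i) (hc : c ∈ symDeg ρ j) :
    hπ.coeffMul b hρ n a c = SymCross.proj ρ b ((i : ℤ) + j - n) (hπ.star b hρ a c) := by
  have ha' := SymCross.symDeg_le_span b i ha
  have hc' := SymCross.symDeg_le_span b j hc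
  clear ha hc
  induction ha' using Submodule.span_induction with
  | mem a ha' =>
    obtain ⟨i, rfl, rfl⟩ := ha'
    induction hc' using Submodule.span_induction with
    | mem c hc' =>
      obtain ⟨j, rfl, rfl⟩ := hc'
      rw [IsLinearPoisson.coeffMul, Module.Basis.constr_basis, Module.Basis.constr_basis]
    | zero => simp
    | add x y _ _ hx hy => rw [map_add, map_add, map_add, hx, hy]
    | smul r x _ hx => rw [map_smul, map_smul, map_smul, hx]
  | zero => simp
  | add x y _ _ hx hy =>
    rw [map_add, map_add, LinearMap.add_apply, LinearMap.add_apply, map_add, hx, hy]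
  | smul r x _ hx =>
    rw [map_smul, map_smul, LinearMap.smul_apply, LinearMap.smul_apply, map_smul, hx]

omit [FiniteDimensional ℝ V] [Fintype Γ] in
theorem SymCross.proj_mem_symDeg (n : ℕ) (a : SymCross ρ) :
    SymCross.proj ρ b n a ∈ symDeg ρ n := by
  induction (SymCross.basis ρ b).mem_span a using Submodule.span_induction with
  | mem a ha =>
    obtain ⟨i, rfl⟩ := ha
    rw [proj_basis]
    split
    · next h =>
      rw [← Nat.cast_inj.1 h]
      exact basis_mem_symDeg ρ b i
    · exact zero_mem _
  | zero => simp
  | add x y _ _ hx hy => rw [map_add]; exact add_mem hx hy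
  | smul r x _ hx => rw [map_smul]; exact Submodule.smul_mem _ _ hx

omit [FiniteDimensional ℝ V] [Fintype Γ] in
-- The degree is an integer so that the ħⁿ coefficient of a product vanishes by itself once n
-- exceeds the total degree.
theorem SymCross.proj_of_neg {k : ℤ} (hk : k < 0) (a : SymCross ρ) :
    SymCross.proj ρ b k a = 0 := by
  have h : SymCross.proj ρ b k = 0 := by
    refine (SymCross.basis ρ b).ext fun i => ?_
    rw [proj_basis, if_neg (by omega), LinearMap.zero_apply]
  rw [h, LinearMap.zero_apply]

omit [FiniteDimensional ℝ V] [Fintype Γ] in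
-- Removing the top n + 1 homogeneous components. The truncated `N - n` is intended: for n ≥ N
-- nothing is left, and `degLT` at 0 is zero.
theorem SymCross.sub_sum_proj_mem_degLT {N : ℕ} {a : SymCross ρ}
    (ha : a ∈ SymCross.degLT ρ b (N + 1)) (n : ℕ) :
    a - ∑ q ∈ Finset.range (n + 1), SymCross.proj ρ b ((N : ℤ) - q) a ∈
      SymCross.degLT ρ b (N - n) := by
  induction ha using Submodule.span_induction with
  | mem a ha =>
    obtain ⟨g, m, hm, rfl⟩ := ha
    simp only [proj_basis]
    by_cases h : N - m.card ≤ n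
    · rw [Finset.sum_eq_single (N - m.card), if_pos (by omega), sub_self]
      · exact zero_mem _
      · intro q _ hq
        exact if_neg (by omega)
      · intro hq
        exact absurd (Finset.mem_range.2 (by omega)) hq
    · rw [Finset.sum_eq_zero, sub_zero]
      · exact Submodule.subset_span ⟨g, m, by omega, rfl⟩
      · intro q hq
        rw [Finset.mem_range] at hq
        exact if_neg (by omega)
  | zero => simp
  | add x y _ _ hx hy =>
    simp only [map_add, Finset.sum_add_distrib, add_sub_add_comm]
    exact add_mem hx hy
  | smul r x _ hx =>
    simp only [map_smul, ← Finset.smul_sum, ← smul_sub]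
    exact Submodule.smul_mem _ _ hx

/-- A total drop of n splits into a drop q in the inner product and n - q in the outer one.
Components of the inner product with drop above n cannot reach degree i + j + k - n, since the outer
product never raises the degree. -/
theorem IsLinearPoisson.sum_coeffMul_left (n : ℕ) {i j k : ℕ} {a c d : SymCross ρ}
    (ha : a ∈ symDeg ρ i) (hc : c ∈ symDeg ρ j) (hd : d ∈ symDeg ρ k) :
    ∑ pq ∈ Finset.HasAntidiagonal.antidiagonal n,
      hπ.coeffMul b hρ pq.1 (hπ.coeffMul b hρ pq.2 a c) d =
    SymCross.proj ρ b ((i : ℤ) + j + k - n) (hπ.star b hρ (hπ.star b hρ a c) d) := by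
  set x := hπ.star b hρ a c with hx
  have h1 : ∀ q ∈ Finset.range (n + 1),
      hπ.coeffMul b hρ (n - q) (hπ.coeffMul b hρ q a c) d =
        SymCross.proj ρ b ((i : ℤ) + j + k - n)
          (hπ.star b hρ (SymCross.proj ρ b (((i + j : ℕ) : ℤ) - q) x) d) := by
    intro q hqn
    rw [Finset.mem_range] at hqn
    rw [hπ.coeffMul_apply b hρ q ha hc, ← Nat.cast_add]
    rcases lt_or_ge (i + j) q with hq | hq
    · rw [SymCross.proj_of_neg b (by omega)]
      simp
    · obtain ⟨e, he⟩ := Nat.exists_eq_add_of_le hq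
      have h2 : (((i + j : ℕ) : ℤ) - q) = (e : ℤ) := by omega
      have h3 : (e : ℤ) + k - (n - q : ℕ) = (i + j : ℕ) + k - n := by omega
      rw [h2, hπ.coeffMul_apply b hρ (n - q) (SymCross.proj_mem_symDeg b e _) hd, h3]
  rw [← Finset.Nat.sum_antidiagonal_swap, Finset.Nat.sum_antidiagonal_eq_sum_range_succ_mk]
  simp only [Prod.swap_prod_mk]
  rw [Finset.sum_congr rfl h1, ← map_sum, ← LinearMap.sum_apply, ← map_sum, ← sub_eq_zero,
    ← map_sub, ← LinearMap.sub_apply, ← map_sub, ← neg_sub x, map_neg, LinearMap.neg_apply, map_neg,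
    neg_eq_zero]
  have h4 := SymCross.sub_sum_proj_mem_degLT b (hπ.star_mem_degLT b hρ ha hc) n
  rw [← hx] at h4
  rcases le_or_gt n (i + j) with hn | hn
  · exact SymCross.proj_of_mem_degLT ρ b (by omega) (hπ.star_mem_degLT_left b hρ h4 hd)
  · rw [Nat.sub_eq_zero_of_le hn.le, SymCross.degLT_zero, Submodule.mem_bot] at h4
    rw [h4, map_zero, LinearMap.zero_apply, map_zero]

theorem IsLinearPoisson.sum_coeffMul_right (n : ℕ) {i j k : ℕ} {a c d : SymCross ρ}
    (ha : a ∈ symDeg ρ i) (hc : c ∈ symDeg ρ j) (hd : d ∈ symDeg ρ k) :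
    ∑ pq ∈ Finset.HasAntidiagonal.antidiagonal n,
      hπ.coeffMul b hρ pq.1 a (hπ.coeffMul b hρ pq.2 c d) =
    SymCross.proj ρ b ((i : ℤ) + j + k - n) (hπ.star b hρ a (hπ.star b hρ c d)) := by
  set x := hπ.star b hρ c d with hx
  have h1 : ∀ q ∈ Finset.range (n + 1),
      hπ.coeffMul b hρ (n - q) a (hπ.coeffMul b hρ q c d) =
        SymCross.proj ρ b ((i : ℤ) + j + k - n)
          (hπ.star b hρ a (SymCross.proj ρ b (((j + k : ℕ) : ℤ) - q) x)) := by
    intro q hqn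
    rw [Finset.mem_range] at hqn
    rw [hπ.coeffMul_apply b hρ q hc hd, ← Nat.cast_add]
    rcases lt_or_ge (j + k) q with hq | hq
    · rw [SymCross.proj_of_neg b (by omega)]
      simp
    · obtain ⟨e, he⟩ := Nat.exists_eq_add_of_le hq
      have h2 : (((j + k : ℕ) : ℤ) - q) = (e : ℤ) := by omega
      have h3 : (i : ℤ) + e - (n - q : ℕ) = i + j + k - n := by omega
      rw [h2, hπ.coeffMul_apply b hρ (n - q) ha (SymCross.proj_mem_symDeg b e _), h3]
  rw [← Finset.Nat.sum_antidiagonal_swap, Finset.Nat.sum_antidiagonal_eq_sum_range_succ_mk]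
  simp only [Prod.swap_prod_mk]
  rw [Finset.sum_congr rfl h1, ← map_sum, ← map_sum, ← sub_eq_zero, ← map_sub, ← map_sub,
    ← neg_sub x, map_neg, map_neg, neg_eq_zero]
  have h4 := SymCross.sub_sum_proj_mem_degLT b (hπ.star_mem_degLT b hρ hc hd) n
  rw [← hx] at h4
  rcases le_or_gt n (j + k) with hn | hn
  · exact SymCross.proj_of_mem_degLT ρ b (by omega) (hπ.star_mem_degLT_right b hρ ha h4)
  · rw [Nat.sub_eq_zero_of_le hn.le, SymCross.degLT_zero, Submodule.mem_bot] at h4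
    rw [h4, map_zero, map_zero]

/-- On homogeneous elements both sums are the same graded component of the two bracketings of one
associative triple product. -/
theorem IsLinearPoisson.coeffMul_assoc (n : ℕ) (a c d : SymCross ρ) :
    ∑ pq ∈ Finset.HasAntidiagonal.antidiagonal n,
      hπ.coeffMul b hρ pq.1 (hπ.coeffMul b hρ pq.2 a c) d =
    ∑ pq ∈ Finset.HasAntidiagonal.antidiagonal n,
      hπ.coeffMul b hρ pq.1 a (hπ.coeffMul b hρ pq.2 c d) := by
  let F : SymCross ρ →ₗ[ℝ] SymCross ρ →ₗ[ℝ] SymCross ρ →ₗ[ℝ] SymCross ρ :=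
    ∑ pq ∈ Finset.HasAntidiagonal.antidiagonal n,
      (hπ.coeffMul b hρ pq.2).compr₂ (hπ.coeffMul b hρ pq.1)
  let G : SymCross ρ →ₗ[ℝ] SymCross ρ →ₗ[ℝ] SymCross ρ →ₗ[ℝ] SymCross ρ :=
    ∑ pq ∈ Finset.HasAntidiagonal.antidiagonal n,
      ((LinearMap.llcomp ℝ (SymCross ρ) (SymCross ρ) (SymCross ρ)) ∘ₗ
        hπ.coeffMul b hρ pq.1).compl₂ (hπ.coeffMul b hρ pq.2)
  have hF : ∀ a c d, F a c d = ∑ pq ∈ Finset.HasAntidiagonal.antidiagonal n,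
      hπ.coeffMul b hρ pq.1 (hπ.coeffMul b hρ pq.2 a c) d := fun a c d => by
    simp [F, LinearMap.sum_apply]
  have hG : ∀ a c d, G a c d = ∑ pq ∈ Finset.HasAntidiagonal.antidiagonal n,
      hπ.coeffMul b hρ pq.1 a (hπ.coeffMul b hρ pq.2 c d) := fun a c d => by
    simp [G, LinearMap.sum_apply]
  rw [← hF, ← hG]
  suffices h : F = G by rw [h]
  refine (SymCross.basis ρ b).ext fun i => (SymCross.basis ρ b).ext fun j =>
    (SymCross.basis ρ b).ext fun k => ?_
  have hi := SymCross.basis_mem_symDeg ρ b i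
  have hj := SymCross.basis_mem_symDeg ρ b j
  have hk := SymCross.basis_mem_symDeg ρ b k
  rw [hF, hG, hπ.sum_coeffMul_left b hρ n hi hj hk, hπ.sum_coeffMul_right b hρ n hi hj hk,
    hπ.star_assoc b hρ]

theorem IsLinearPoisson.coeffMul_zero (a c : SymCross ρ) : hπ.coeffMul b hρ 0 a c = a * c := by
  suffices h : hπ.coeffMul b hρ 0 = LinearMap.mul ℝ (SymCross ρ) by
    rw [h, LinearMap.mul_apply']
  refine (SymCross.basis ρ b).ext fun i => (SymCross.basis ρ b).ext fun j => ?_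
  have hi := SymCross.basis_mem_symDeg ρ b i
  have hj := SymCross.basis_mem_symDeg ρ b j
  have h1 := SymCross.proj_of_mem_degLT ρ b le_rfl (hπ.star_sub_mul_mem_degLT b hρ hi hj)
  rw [map_sub, sub_eq_zero, SymCross.proj_of_mem_symDeg ρ b _ (SymCross.mul_mem_symDeg ρ hi hj),
    if_pos rfl] at h1
  rw [hπ.coeffMul_apply b hρ 0 hi hj, LinearMap.mul_apply', Nat.cast_zero, sub_zero,
    ← Nat.cast_add, h1]

theorem IsLinearPoisson.coeffMul_grp_left {n : ℕ} (hn : 1 ≤ n) (g : Γ) (a : SymCross ρ) :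
    hπ.coeffMul b hρ n (SymCross.grp ρ g) a = 0 := by
  suffices h : hπ.coeffMul b hρ n (SymCross.grp ρ g) = 0 by rw [h, LinearMap.zero_apply]
  refine (SymCross.basis ρ b).ext fun i => ?_
  have hg := SymCross.grp_mem_symDeg ρ g
  have hi := SymCross.basis_mem_symDeg ρ b i
  rw [hπ.coeffMul_apply b hρ n hg hi, hπ.star_grp_left,
    SymCross.proj_of_mem_symDeg ρ b _ (SymCross.mul_mem_symDeg ρ hg hi), if_neg (by omega),
    LinearMap.zero_apply]

theorem IsLinearPoisson.coeffMul_grp_right {n : ℕ} (hn : 1 ≤ n) (g : Γ) (a : SymCross ρ) :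
    hπ.coeffMul b hρ n a (SymCross.grp ρ g) = 0 := by
  suffices h : (hπ.coeffMul b hρ n).flip (SymCross.grp ρ g) = 0 by
    rw [← LinearMap.flip_apply, h, LinearMap.zero_apply]
  refine (SymCross.basis ρ b).ext fun i => ?_
  have hg := SymCross.grp_mem_symDeg ρ g
  have hi := SymCross.basis_mem_symDeg ρ b i
  rw [LinearMap.flip_apply, hπ.coeffMul_apply b hρ n hi hg, hπ.star_grp_right,
    SymCross.proj_of_mem_symDeg ρ b _ (SymCross.mul_mem_symDeg ρ hi hg), if_neg (by omega),
    LinearMap.zero_apply]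

/-- The commutator in the transported product is homogeneous of degree 1, and the ħⁿ coefficient
extracts degree 2 - n. -/
theorem IsLinearPoisson.coeffMul_vec_sub (n : ℕ) (x y : Module.Dual ℝ V) :
    hπ.coeffMul b hρ n (SymCross.vec ρ x 1) (SymCross.vec ρ y 1) -
      hπ.coeffMul b hρ n (SymCross.vec ρ y 1) (SymCross.vec ρ x 1) =
      if n = 1 then ∑ γ : Γ, SymCross.vec ρ (π γ x y) γ else 0 := by
  have hx := SymCross.vec_mem_symDeg ρ x (1 : Γ)
  have hy := SymCross.vec_mem_symDeg ρ y (1 : Γ)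
  have hs : ∑ γ : Γ, SymCross.vec ρ (π γ x y) γ ∈ symDeg ρ 1 :=
    Submodule.sum_mem _ fun γ _ => SymCross.vec_mem_symDeg ρ _ γ
  rw [hπ.coeffMul_apply b hρ n hx hy, hπ.coeffMul_apply b hρ n hy hx, ← map_sub,
    hπ.star_vec_sub b hρ, SymCross.proj_of_mem_symDeg ρ b _ hs]
  congr 1
  apply propext
  omega

/-- The formal deformation obtained from `A_π` by homogenization. -/
def IsLinearPoisson.formalDeformation : FormalDeformation (SymCross ρ) where
  m := hπ.coeffMul b hρ
  m_zero := hπ.coeffMul_zero b hρ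
  assoc := hπ.coeffMul_assoc b hρ
  one_left _ hn a := hπ.coeffMul_grp_left b hρ hn 1 a
  one_right _ hn a := hπ.coeffMul_grp_right b hρ hn 1 a

theorem IsLinearPoisson.isQuantization_formalDeformation :
    IsQuantization ρ π (hπ.formalDeformation b hρ) where
  group_left _ hn g a := hπ.coeffMul_grp_left b hρ hn g a
  group_right _ hn g a := hπ.coeffMul_grp_right b hρ hn g a
  first_order x y := (hπ.coeffMul_vec_sub b hρ 1 x y).trans (if_pos rfl)

theorem IsLinearPoisson.noHigherCorrection_formalDeformation :
    NoHigherCorrection ρ (hπ.formalDeformation b hρ) := fun n hn x y =>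
  sub_eq_zero.1 ((hπ.coeffMul_vec_sub b hρ n x y).trans (if_neg (by omega)))

end Homogenize

end OrbifoldPoisson

end

theorem mainTheorem3 {Γ V : Type*} [CommGroup Γ] [Fintype Γ] [AddCommGroup V] [Module ℝ V]
    [FiniteDimensional ℝ V] (ρ : Representation ℝ Γ V) (hρ : Function.Injective ρ)
    (π : OrbifoldPoisson.LinearCochain Γ V) (hπ : OrbifoldPoisson.IsLinearPoisson ρ π) :
    OrbifoldPoisson.BravermanGaitsgory ρ π ∧
      OrbifoldPoisson.HasPBW ρ π ∧
      ∃ D : OrbifoldPoisson.FormalDeformation (OrbifoldPoisson.SymCross ρ),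
        OrbifoldPoisson.IsQuantization ρ π D ∧ OrbifoldPoisson.NoHigherCorrection ρ D :=
  ⟨hπ.bravermanGaitsgory hρ, hπ.hasPBW hρ,
    hπ.formalDeformation (Module.finBasis ℝ (Module.Dual ℝ V)) hρ,
    hπ.isQuantization_formalDeformation _ hρ, hπ.noHigherCorrection_formalDeformation _ hρ⟩
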